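/- Let $(X,\mu)$ be a measure space, $H$ a complex Hilbert space, and $A$ a (possibly unbounded) positive self-adjoint operator on $\mathcal H = L^2(X,\mu;H)$. Let $\Pi_{[0,\lambda]}=\chi_A([0,\lambda])$ and $\Pi_{]0,\lambda]}=\chi_A(]0,\lambda])$, $\lambda\ge 0$, be its spectral projections. For a bounded positive operator $P$ on $\mathcal H$ and a measurable set $\Omega\subset X$ put $\nu_P(\Omega)=\tau(\chi_\Omega P\chi_\Omega)\in[0,\infty]$, where $\tau$ is the trace and $\chi_\Omega$ is multiplication by the indicator function of $\Omega$. Let $X=\bigsqcup_{i\in I}\Omega_i$ be a partition of $X$ into countably many measurable sets and let $\rho$ be a non-zero bounded positive operator on $\mathcal H$, with operator norm $\|\rho\|$ and energy $\mathcal E(\rho)=\tau(\rho^{1/2}A\rho^{1/2})=\sum_k\|A^{1/2}\rho^{1/2}e_k\|^2\in[0,\infty]$, where $(e_k)$ is a Hilbert basis of $\mathcal H$ and $\|A^{1/2}f\|=\infty$ if $f$ is not in the domain of $A^{1/2}$. Let either - $\Pi_\lambda=\Pi_{[0,\lambda]}$ for all $\lambda\ge0$, with no further assumption on $\rho$, or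 - $\Pi_\lambda=\Pi_{]0,\lambda]}$ for all $\lambda\ge0$, assuming in addition that $\rho=0$ on $\ker A$. Set $F_{\Omega_i}(\lambda)=\nu_{\Pi_\lambda}(\Omega_i)\in[0,\infty]$ for $\lambda\ge0$, and for $u\in[0,\infty]$ $$F_{\Omega_i}^{-1}(u)=\begin{cases}0 & \text{if } u<F_{\Omega_i}(0),\\ \sup\{\lambda\ge 0 \mid F_{\Omega_i}(\lambda)\le u,\ F_{\Omega_i}(\lambda)<\infty\} & \text{otherwise,}\end{cases}$$ an element of $[0,\infty]$, where $\sup\emptyset=0$ (the condition $F_{\Omega_i}(\lambda)<\infty$ matters only for $u=\infty$). Then, in $[0,\infty]$ and with $0\cdot\infty=0$, $$\sum_{i\in I} F_{\Omega_i}^{-1}\Bigl(\frac{\nu_\rho(\Omega_i)}{4\|\rho\|}\Bigr)\,\nu_\rho(\Omega_i)\;\le\;4\,\mathcal E(\rho).$$ -/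

import Mathlib

open MeasureTheory Set Filter Topology
open scoped ENNReal NNReal

noncomputable section

namespace MixedState

section Hilbert

variable (E : Type*) [NormedAddCommGroup E] [InnerProductSpace ℂ E] [CompleteSpace E]

/-- A spectral family (resolution of the identity) on the Hilbert space `E`: an increasing,
strongly right-continuous family of orthogonal projections `P l`, `l ∈ ℝ`, which tends strongly
to `0` at `-∞` and to the identity at `+∞`. -/
structure SpectralFamily where
  proj : ℝ → E →L[ℂ] E
  isStarProjection : ∀ l, IsStarProjection (proj l)
  mono : Monotone proj
  rightContinuous : ∀ (f : E) (l : ℝ), ContinuousWithinAt (fun m => proj m f) (Ici l) l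
  tendsto_atBot : ∀ f : E, Tendsto (fun l => proj l f) atBot (𝓝 0)
  tendsto_atTop : ∀ f : E, Tendsto (fun l => proj l f) atTop (𝓝 f)

/-- The spectral family of the zero operator. -/
instance : Inhabited (SpectralFamily E) where
  default :=
    { proj := fun l => if l < 0 then 0 else 1
      isStarProjection := by
        intro l
        by_cases h : l < 0
        · simp [h]
        · simp [h]
      mono := by
        intro l m hlm
        by_cases hm : m < 0
        · simp [hm, lt_of_le_of_lt hlm hm]
        · by_cases hl : l < 0
          · simp only [hl, hm, if_true, if_false]
            exact (IsStarProjection.one (E →L[ℂ] E)).nonneg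
          · simp [hl, hm]
      rightContinuous := by
        intro f l
        by_cases hl : l < 0
        · have h : (fun m : ℝ => (if m < 0 then (0 : E →L[ℂ] E) else 1) f) =ᶠ[𝓝 l]
              fun _ => (0 : E) := by
            filter_upwards [Iio_mem_nhds hl] with m hm
            have hm' : m < 0 := hm
            simp [hm']
          exact (continuousAt_const.congr h.symm).continuousWithinAt
        · have h : ∀ m ∈ Ici l,
              (fun m : ℝ => (if m < 0 then (0 : E →L[ℂ] E) else 1) f) m = f := by
            intro m hm
            have hm' : ¬ m < 0 := not_lt.2 ((not_lt.1 hl).trans hm)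
            simp [hm']
          exact continuousWithinAt_const.congr h (h l self_mem_Ici)
      tendsto_atBot := by
        intro f
        refine tendsto_const_nhds.congr' ?_
        filter_upwards [eventually_lt_atBot (0 : ℝ)] with l hl
        simp [hl]
      tendsto_atTop := by
        intro f
        refine tendsto_const_nhds.congr' ?_
        filter_upwards [eventually_ge_atTop (0 : ℝ)] with l hl
        simp [not_lt.2 hl] }

variable {E}

theorem norm_sq_eq_reApplyInnerSelf {p : E →L[ℂ] E} (hp : IsStarProjection p) (f : E) :
    ‖p f‖ ^ 2 = p.reApplyInnerSelf f := by
  have h1 : p (p f) = p f := congrArg (fun T : E →L[ℂ] E => T f) hp.isIdempotentElem.eq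
  have h2 : inner ℂ (p f) (p f) = inner ℂ (p (p f)) f := by
    have := ContinuousLinearMap.adjoint_inner_left p f (p f)
    rw [← ContinuousLinearMap.star_eq_adjoint, hp.isSelfAdjoint.star_eq] at this
    exact this.symm
  rw [ContinuousLinearMap.reApplyInnerSelf_apply, ← h1, ← h2, inner_self_eq_norm_sq, h1]

/-- The function `l ↦ ‖P_l f‖² = ⟨P_l f, f⟩`. -/
def SpectralFamily.distribution (P : SpectralFamily E) (f : E) : StieltjesFunction ℝ where
  toFun l := ‖P.proj l f‖ ^ 2
  mono' := by
    intro l m hlm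
    have h := (ContinuousLinearMap.le_def _ _).1 (P.mono hlm)
    have h' := h.2 f
    simp only [norm_sq_eq_reApplyInnerSelf (P.isStarProjection _)]
    simp only [ContinuousLinearMap.reApplyInnerSelf_apply, sub_nonneg, map_sub, inner_sub_left,
      sub_apply] at h' ⊢
    simpa using h'
  right_continuous' l := (P.rightContinuous f l).norm.pow 2

/-- The spectral measure `d⟨P_l f, f⟩` of the vector `f`. -/
def SpectralFamily.scalarMeasure (P : SpectralFamily E) (f : E) : Measure ℝ :=
  (P.distribution f).measure

/-- `P` is the spectral family of the self-adjoint operator `A`, i.e. `A = ∫ l dP_l`: the domain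
of `A` is `{f | ∫ l² d⟨P_l f, f⟩ < ∞}`, and `⟨A f, f⟩ = ∫ l d⟨P_l f, f⟩` on this domain
(by polarization this determines `A` completely). -/
def IsSpectralFamilyOf (P : SpectralFamily E) (A : E →ₗ.[ℂ] E) : Prop :=
  (∀ f : E, f ∈ A.domain ↔ ∫⁻ l, ENNReal.ofReal (l ^ 2) ∂(P.scalarMeasure f) < ∞) ∧
  ∀ f : A.domain, inner ℂ (f : E) (A f) = ((∫ l, l ∂(P.scalarMeasure f) : ℝ) : ℂ)

/-- The spectral family of the self-adjoint operator `A`. By the spectral theorem there is exactly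
one `P` with `IsSpectralFamilyOf P A`; `Classical.epsilon` picks it. -/
def spectralFamily (A : E →ₗ.[ℂ] E) : SpectralFamily E :=
  Classical.epsilon fun P => IsSpectralFamilyOf P A

/-- `A` is a (possibly unbounded) positive self-adjoint operator. -/
structure IsPositiveSelfAdjoint (A : E →ₗ.[ℂ] E) : Prop where
  isSelfAdjoint : IsSelfAdjoint A
  nonneg : ∀ f : A.domain, 0 ≤ (inner ℂ (f : E) (A f)).re

/-- The spectral projection `χ_A([0, l])` of a positive self-adjoint operator `A`; since `A` is
positive, `χ_A([0, l]) = χ_A(]-∞, l])`. -/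
def specProjIcc (A : E →ₗ.[ℂ] E) (l : ℝ) : E →L[ℂ] E :=
  (spectralFamily A).proj l

/-- The spectral projection `χ_A(]0, l]) = χ_A(]-∞, l]) - χ_A(]-∞, 0])`, `0 ≤ l`. -/
def specProjIoc (A : E →ₗ.[ℂ] E) (l : ℝ) : E →L[ℂ] E :=
  (spectralFamily A).proj l - (spectralFamily A).proj 0

/-- The closed quadratic form `f ↦ ‖A^{1/2} f‖² = ∫ l d⟨P_l f, f⟩` of a positive self-adjoint
operator `A`, equal to `∞` when `f` is not in the domain of `A^{1/2}`. -/
def quadForm (A : E →ₗ.[ℂ] E) (f : E) : ℝ≥0∞ :=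
  ∫⁻ l, ENNReal.ofReal l ∂((spectralFamily A).scalarMeasure f)

variable (E) in
/-- The index set of a Hilbert basis of `E`. -/
def basisIndex : Set E := (exists_hilbertBasis ℂ E).choose

variable (E) in
/-- A Hilbert basis of `E`. -/
def basis : HilbertBasis (basisIndex E) ℂ E := (exists_hilbertBasis ℂ E).choose_spec.choose

/-- The trace `∑ q(e_i) ∈ [0, ∞]`, over a Hilbert basis `(e_i)`, of a positive form `q`; for the
forms used below (of the shape `q(f) = ‖T f‖²`, `T` closed) it does not depend on the basis. -/
def formTrace (q : E → ℝ≥0∞) : ℝ≥0∞ := ∑' i, q (basis E i)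

/-- The trace `τ(P) ∈ [0, ∞]` of a bounded positive operator `P`. -/
def opTrace (P : E →L[ℂ] E) : ℝ≥0∞ :=
  formTrace fun f => ENNReal.ofReal (inner ℂ f (P f)).re

/-- The energy `𝓔(ρ) = τ(ρ^{1/2} A ρ^{1/2}) ∈ [0, ∞]`; the quadratic form of
`ρ^{1/2} A ρ^{1/2}` is `f ↦ ‖A^{1/2} ρ^{1/2} f‖²`. -/
def energy (A : E →ₗ.[ℂ] E) (ρ : E →L[ℂ] E) : ℝ≥0∞ :=
  formTrace fun f => quadForm A (CFC.sqrt ρ f)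

end Hilbert

section L2

variable {X : Type*} [MeasurableSpace X] {μ : Measure X}
  {H : Type*} [NormedAddCommGroup H] [InnerProductSpace ℂ H]

/-- The operator `χ_Ω` on `L²(X, H)` of multiplication by the indicator function of `Ω`. -/
def chi {Ω : Set X} (hΩ : MeasurableSet Ω) : Lp H 2 μ →L[ℂ] Lp H 2 μ :=
  LinearMap.mkContinuous
    { toFun := fun f => ((Lp.memLp f).indicator hΩ).toLp (Ω.indicator f)
      map_add' := by
        intro f g
        apply Lp.ext
        refine (MemLp.coeFn_toLp _).trans ?_
        refine EventuallyEq.trans ?_ (Lp.coeFn_add _ _).symm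
        filter_upwards [Lp.coeFn_add f g, ((Lp.memLp f).indicator hΩ).coeFn_toLp,
          ((Lp.memLp g).indicator hΩ).coeFn_toLp] with x h1 h2 h3
        simp only [Pi.add_apply, h2, h3]
        by_cases hx : x ∈ Ω
        · simp only [indicator_of_mem hx]
          exact h1
        · simp only [indicator_of_notMem hx, add_zero]
      map_smul' := by
        intro c f
        apply Lp.ext
        refine (MemLp.coeFn_toLp _).trans ?_
        refine EventuallyEq.trans ?_ (Lp.coeFn_smul _ _).symm
        filter_upwards [Lp.coeFn_smul c f, ((Lp.memLp f).indicator hΩ).coeFn_toLp] with x h1 h2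
        simp only [Pi.smul_apply, RingHom.id_apply, h2]
        by_cases hx : x ∈ Ω
        · simp only [indicator_of_mem hx]
          exact h1
        · simp only [indicator_of_notMem hx, smul_zero] }
    1 (by
      intro f
      rw [one_mul]
      refine Lp.norm_le_norm_of_ae_le ?_
      filter_upwards [((Lp.memLp f).indicator hΩ).coeFn_toLp] with x hx
      simp only [LinearMap.coe_mk, AddHom.coe_mk, hx]
      exact norm_indicator_le_norm_self _ _)

variable [CompleteSpace H]

/-- `ν_P(Ω) = τ(χ_Ω P χ_Ω)`. -/
def nu (P : Lp H 2 μ →L[ℂ] Lp H 2 μ) {Ω : Set X} (hΩ : MeasurableSet Ω) : ℝ≥0∞ :=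
  opTrace (chi hΩ ∘L P ∘L chi hΩ)

end L2

open scoped Classical in
/-- The right-continuous inverse of an increasing function `F : [0, ∞[ → [0, ∞]`:
`F⁻¹(u) = 0` if `u < F(0)`, and `F⁻¹(u) = sup {l ≥ 0 | F(l) ≤ u}` otherwise. Only those `l` with
`F(l) < ∞` are taken into account; this matters for `u = ∞` only. -/
def rightInv (F : ℝ≥0 → ℝ≥0∞) (u : ℝ≥0∞) : ℝ≥0∞ :=
  if u < F 0 then 0 else ⨆ (l : ℝ≥0) (_ : F l ≤ u ∧ F l < ∞), (l : ℝ≥0∞)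

end MixedState

end

/-! Write P_λ for the spectral family of A, S = ρ^{1/2}, and ‖·‖₂ for the Hilbert–Schmidt norm, so
that ν_ρ(Ω) = ‖S χ_Ω‖₂². Splitting χ_Ω into its parts below and above energy λ gives ν_ρ(Ω) ≤ 2‖S
Π_λ χ_Ω‖₂² + 2‖S(1 - P_λ)χ_Ω‖₂² ≤ 2‖ρ‖ F_Ω(λ) + 2 T_Ω(λ), where T_Ω(λ) = ‖χ_Ω(1 - P_λ)S‖₂². If
F_Ω(λ) ≤ ν_ρ(Ω)/(4‖ρ‖), the first term is at most half of the left side, and ν_ρ(Ω) ≤ 4 T_Ω(λ)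
(`nu_le_four_mul_tailNu`). As F_Ω increases, this persists for all smaller λ, and integrating in λ
produces the factor F_Ω⁻¹ (`rightInv_mul_nu_le`). The cutoffs of the partition satisfy Σ ‖χ_{Ω_i}
g‖² = ‖g‖², and the layer-cake formula reads ∫₀^∞ ‖f - P_λ f‖² dλ = ‖A^{1/2} f‖²
(`quadForm_eq_lintegral`); hence the integrated tails sum to at most the energy
(`tsum_lintegral_tailNu_le`).

For Π_λ = P_λ - P_0 the same argument works once S P_0 = 0. Since `spectralFamily A` is obtained by
choice, this rests on the spectral theorem. It is proved through the bounded functional calculus of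
R = (1 + A)⁻¹: for l ≥ 0 the range of P_l is the kernel of ((1 + l)⁻¹ - R)₊, on the slice between x
and y the operator A is within y - x of the scalar x, and Riemann sums turn this into the moment
identities (`isSpectralFamilyOf_of_slices`). -/

namespace MixedState

/-! ### The bounded resolvent (1 + A)⁻¹. -/

section Resolvent

variable {E : Type*} [NormedAddCommGroup E] [InnerProductSpace ℂ E] [CompleteSpace E]
  {A : E →ₗ.[ℂ] E}

theorem IsPositiveSelfAdjoint.inner_symm (hA : IsPositiveSelfAdjoint A) (x y : A.domain) :
    inner ℂ (A x) (y : E) = inner ℂ (x : E) (A y) := by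
  have h := LinearPMap.adjoint_isFormalAdjoint hA.isSelfAdjoint.dense_domain
  rw [LinearPMap.isSelfAdjoint_def.1 hA.isSelfAdjoint] at h
  exact h x y

/-- Cauchy–Schwarz applied to ‖z‖² ≤ Re⟨z, z + Az⟩. This one bound yields injectivity, closed range
and contractivity of the inverse of 1 + A. -/
theorem IsPositiveSelfAdjoint.norm_le_norm_add (hA : IsPositiveSelfAdjoint A) (z : A.domain) :
    ‖(z : E)‖ ≤ ‖(z : E) + A z‖ := by
  have h1 : ‖(z : E)‖ ^ 2 ≤ (inner ℂ (z : E) ((z : E) + A z)).re := by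
    rw [inner_add_right, Complex.add_re]
    have := hA.nonneg z
    have h2 : (inner ℂ (z : E) (z : E)).re = ‖(z : E)‖ ^ 2 := inner_self_eq_norm_sq (𝕜 := ℂ) _
    linarith
  have h3 : (inner ℂ (z : E) ((z : E) + A z)).re ≤ ‖(z : E)‖ * ‖(z : E) + A z‖ :=
    re_inner_le_norm (𝕜 := ℂ) _ _
  rcases (norm_nonneg (z : E)).eq_or_lt with h | h
  · rw [← h]; positivity
  · nlinarith

/-- A vector on which the form `x ↦ ⟨w, x⟩` represents `⟨y, A x⟩` lies in the domain. -/
theorem IsPositiveSelfAdjoint.mem_domain_of_inner (hA : IsPositiveSelfAdjoint A) {y w : E}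
    (h : ∀ x : A.domain, inner ℂ w (x : E) = inner ℂ y (A x)) :
    ∃ z : A.domain, (z : E) = y ∧ A z = w := by
  have hd := hA.isSelfAdjoint.dense_domain
  have hs := LinearPMap.isSelfAdjoint_def.1 hA.isSelfAdjoint
  have hy := LinearPMap.mem_adjoint_domain_of_exists (T := A) y ⟨w, h⟩
  have hy' := LinearPMap.adjoint_apply_eq hd ⟨y, hy⟩ h
  have hg : (y, w) ∈ (A.adjoint).graph := by
    rw [LinearPMap.mem_graph_iff]; exact ⟨⟨y, hy⟩, rfl, hy'⟩
  rw [hs, LinearPMap.mem_graph_iff] at hg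
  exact hg

theorem IsPositiveSelfAdjoint.mem_domain_of_tendsto (hA : IsPositiveSelfAdjoint A)
    {α : Type*} {l : Filter α} [l.NeBot] {z : α → A.domain} {x y : E}
    (hx : Tendsto (fun n => (z n : E)) l (𝓝 x))
    (hy : Tendsto (fun n => A (z n)) l (𝓝 y)) : ∃ w : A.domain, (w : E) = x ∧ A w = y := by
  have hc : _root_.IsClosed (A.graph : Set (E × E)) := hA.isSelfAdjoint.isClosed
  have : (x, y) ∈ (A.graph : Set (E × E)) := hc.mem_of_tendsto (hx.prodMk_nhds hy)
    (Eventually.of_forall fun n => LinearPMap.mem_graph A (z n))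
  simpa [LinearPMap.mem_graph_iff] using this

/-- The operator `1 + A` on the domain of `A`. -/
def oneAdd (A : E →ₗ.[ℂ] E) : A.domain →ₗ[ℂ] E := A.domain.subtype + A.toFun

omit [CompleteSpace E] in
theorem oneAdd_apply (z : A.domain) : oneAdd A z = (z : E) + A z := rfl

theorem IsPositiveSelfAdjoint.oneAdd_injective (hA : IsPositiveSelfAdjoint A) :
    Function.Injective (oneAdd A) := by
  rw [← LinearMap.ker_eq_bot, LinearMap.ker_eq_bot']
  intro z hz
  have := hA.norm_le_norm_add z
  rw [← oneAdd_apply, hz, norm_zero, norm_le_zero_iff] at this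
  exact Subtype.ext this

theorem IsPositiveSelfAdjoint.oneAdd_surjective (hA : IsPositiveSelfAdjoint A) :
    Function.Surjective (oneAdd A) := by
  have hcl : IsClosed ((LinearMap.range (oneAdd A) : Submodule ℂ E) : Set E) := by
    refine IsSeqClosed.isClosed ?_
    intro x y hx hxy
    choose z hz using hx
    have hcau : CauchySeq fun n => (z n : E) := by
      have h1 := hxy.cauchySeq
      rw [Metric.cauchySeq_iff] at h1 ⊢
      intro ε hε
      obtain ⟨N, hN⟩ := h1 ε hε
      refine ⟨N, fun m hm n hn => lt_of_le_of_lt ?_ (hN m hm n hn)⟩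
      have := hA.norm_le_norm_add (z m - z n)
      rw [← oneAdd_apply, map_sub, hz, hz] at this
      simpa [dist_eq_norm] using this
    obtain ⟨w, hw⟩ := cauchySeq_tendsto_of_complete hcau
    have hAz : Tendsto (fun n => A (z n)) atTop (𝓝 (y - w)) := by
      refine (hxy.sub hw).congr fun n => ?_
      rw [← hz n, oneAdd_apply, add_sub_cancel_left]
    obtain ⟨v, hv, hv'⟩ := hA.mem_domain_of_tendsto hw hAz
    exact ⟨v, by rw [oneAdd_apply, hv, hv']; abel⟩
  have hort : (LinearMap.range (oneAdd A))ᗮ = ⊥ := by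
    rw [Submodule.eq_bot_iff]
    intro y hy
    -- Orthogonality to the range puts y in the domain of A* = A with Ay = -y, which positivity
    -- allows only for y = 0.
    have h : ∀ x : A.domain, inner ℂ (-y) (x : E) = inner ℂ y (A x) := by
      intro x
      have := Submodule.inner_left_of_mem_orthogonal (LinearMap.mem_range_self (oneAdd A) x) hy
      rw [oneAdd_apply, inner_add_right] at this
      rw [inner_neg_left]
      linear_combination -this
    obtain ⟨z, hz, hz'⟩ := hA.mem_domain_of_inner h
    have := hA.nonneg z
    rw [hz, hz', inner_neg_right, Complex.neg_re] at this
    have h2 : (inner ℂ y y).re = ‖y‖ ^ 2 := inner_self_eq_norm_sq (𝕜 := ℂ) _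
    have : ‖y‖ ^ 2 = 0 := by nlinarith [sq_nonneg ‖y‖]
    simpa using this
  rw [← LinearMap.range_eq_top]
  have : CompleteSpace (LinearMap.range (oneAdd A)) := hcl.completeSpace_coe
  exact Submodule.orthogonal_eq_bot_iff.1 hort

/-- The resolvent `(1 + A)⁻¹`. -/
theorem IsPositiveSelfAdjoint.exists_resolvent (hA : IsPositiveSelfAdjoint A) :
    ∃ R : E →L[ℂ] E, 0 ≤ R ∧ R ≤ 1 ∧ (∀ x, ∃ z : A.domain, (z : E) = R x ∧ A z = x - R x) ∧
      ∀ z : A.domain, R (z + A z) = z := by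
  let e := LinearEquiv.ofBijective (oneAdd A) ⟨hA.oneAdd_injective, hA.oneAdd_surjective⟩
  have he : ∀ x, ((e.symm x : A.domain) : E) + A (e.symm x) = x := fun x => e.apply_symm_apply x
  let R : E →L[ℂ] E := LinearMap.mkContinuous (A.domain.subtype ∘ₗ e.symm.toLinearMap) 1 (by
    intro x
    have := hA.norm_le_norm_add (e.symm x)
    rw [he] at this
    simpa using this)
  have hR : ∀ x, R x = (e.symm x : A.domain) := fun x => rfl
  have hle : ∀ x, ‖R x‖ ≤ ‖x‖ := fun x => by
    have := hA.norm_le_norm_add (e.symm x)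
    rwa [he] at this
  have hsymm : ∀ x y, inner ℂ (R x) y = inner ℂ x (R y) := by
    intro x y
    conv_lhs => rw [← he y]
    conv_rhs => rw [← he x]
    rw [hR, hR, inner_add_right, inner_add_left, hA.inner_symm]
  refine ⟨R, ?_, ?_, ?_, ?_⟩
  · rw [ContinuousLinearMap.nonneg_iff_isPositive]
    refine ⟨hsymm, fun x => ?_⟩
    have h2 := inner_self_nonneg (𝕜 := ℂ) (x := (e.symm x : E))
    have h3 := hA.nonneg (e.symm x)
    have h4 : inner ℂ (R x) x
        = inner ℂ (e.symm x : E) (e.symm x : E) + inner ℂ (e.symm x : E) (A (e.symm x)) := by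
      rw [hR, ← inner_add_right, he]
    rw [ContinuousLinearMap.reApplyInnerSelf_apply, h4, map_add]
    exact add_nonneg h2 h3
  · rw [ContinuousLinearMap.le_def]
    refine ⟨fun x y => ?_, fun x => ?_⟩
    · have := hsymm x y
      simp [inner_sub_left, inner_sub_right] at this ⊢
      exact this
    · rw [ContinuousLinearMap.reApplyInnerSelf_apply, sub_apply, inner_sub_left, map_sub,
        one_apply_eq_self, inner_self_eq_norm_sq, sub_nonneg]
      calc RCLike.re (inner ℂ (R x) x) ≤ ‖R x‖ * ‖x‖ := re_inner_le_norm _ _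
        _ ≤ ‖x‖ * ‖x‖ := by gcongr; exact hle x
        _ = ‖x‖ ^ 2 := by ring
  · intro x
    exact ⟨e.symm x, rfl, by rw [hR]; exact eq_sub_of_add_eq' (he x)⟩
  · intro z
    rw [hR]
    congr 1
    exact e.symm_apply_apply z

end Resolvent

/-! ### Spectral subspaces of R via continuous functions. -/

section BoundedCalculus

variable {E : Type*} [NormedAddCommGroup E] [InnerProductSpace ℂ E] [CompleteSpace E]

/-- The kernel of the operator `(c - R)₊`, i.e. the range of `χ_R([c, ∞[)`. -/
noncomputable def upperSpace (R : E →L[ℂ] E) (c : ℝ) : Submodule ℂ E :=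
  LinearMap.ker (cfc (fun t : ℝ => max (c - t) 0) R : E →L[ℂ] E).toLinearMap

theorem mem_upperSpace {R : E →L[ℂ] E} {c : ℝ} {x : E} :
    x ∈ upperSpace R c ↔ cfc (fun t : ℝ => max (c - t) 0) R x = 0 := Iff.rfl

theorem isClosed_upperSpace (R : E →L[ℂ] E) (c : ℝ) : IsClosed (upperSpace R c : Set E) :=
  ContinuousLinearMap.isClosed_ker (cfc (fun t : ℝ => max (c - t) 0) R)

variable {R : E →L[ℂ] E}

theorem cfc_apply_cfc_apply {f g : ℝ → ℝ} (hf : Continuous f) (hg : Continuous g) (x : E) :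
    cfc f R (cfc g R x) = cfc (fun t => f t * g t) R x := by
  rw [cfc_mul f g R hf.continuousOn hg.continuousOn]; rfl

theorem cfc_apply_comm {f g : ℝ → ℝ} (hf : Continuous f) (hg : Continuous g) (x : E) :
    cfc f R (cfc g R x) = cfc g R (cfc f R x) := by
  rw [cfc_apply_cfc_apply hf hg, cfc_apply_cfc_apply hg hf]
  simp only [mul_comm]

theorem cfc_apply_mem_upperSpace {g : ℝ → ℝ} (hg : Continuous g) {c : ℝ} {x : E}
    (hx : x ∈ upperSpace R c) : cfc g R x ∈ upperSpace R c := by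
  rw [mem_upperSpace] at hx ⊢
  rw [cfc_apply_comm (by fun_prop) hg, hx, map_zero]

/-- For c' < c, (c' - t)₊ is a continuous multiple of (c - t)₊: bounding the denominator below by c
- c' changes nothing where the numerator is non-zero. -/
theorem upperSpace_anti (R : E →L[ℂ] E) : Antitone (upperSpace R) := by
  intro c' c h x hx
  rcases h.eq_or_lt with rfl | h
  · exact hx
  rw [mem_upperSpace] at hx ⊢
  have hpos : ∀ t, 0 < max (c - t) (c - c') := fun t => lt_max_of_lt_right (by linarith)
  have hg : Continuous fun t : ℝ => max (c' - t) 0 / max (c - t) (c - c') :=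
    Continuous.div (by fun_prop) (by fun_prop) fun t => (hpos t).ne'
  have heq : (fun t : ℝ => max (c' - t) 0)
      = fun t => max (c' - t) 0 / max (c - t) (c - c') * max (c - t) 0 := by
    funext t
    rcases le_total c' t with ht | ht
    · simp [max_eq_right (sub_nonpos.2 ht)]
    · rw [max_eq_left (a := c - t) (by linarith), max_eq_left (a := c - t) (by linarith),
        div_mul_cancel₀ _ (by linarith)]
  rw [heq, ← cfc_apply_cfc_apply hg (by fun_prop), hx, map_zero]

theorem cfc_posPart_mem_upperSpace (c : ℝ) (y : E) :
    cfc (fun t : ℝ => max (t - c) 0) R y ∈ upperSpace R c := by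
  rw [mem_upperSpace, cfc_apply_cfc_apply (by fun_prop) (by fun_prop)]
  have : (fun t : ℝ => max (c - t) 0 * max (t - c) 0) = fun _ => 0 := by
    funext t
    rcases le_total c t with h | h
    · rw [max_eq_right (sub_nonpos.2 h), zero_mul]
    · rw [max_eq_right (a := t - c) (sub_nonpos.2 h), mul_zero]
  rw [this]
  simp

/-- With B = (R - c)₊, the vector B(Bx) lies in `upperSpace R c`, so ‖Bx‖² = ⟨x, B(Bx)⟩ = 0. Thus R
≤ c on the orthogonal complement. -/
theorem cfc_posPart_eq_zero {c : ℝ} {x : E} (hx : x ∈ (upperSpace R c)ᗮ) :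
    cfc (fun t : ℝ => max (t - c) 0) R x = 0 := by
  have hs : IsSelfAdjoint (cfc (fun t : ℝ => max (t - c) 0) R) := cfc_predicate _ _
  have h1 := Submodule.inner_left_of_mem_orthogonal
    (cfc_posPart_mem_upperSpace (R := R) c (cfc (fun t : ℝ => max (t - c) 0) R x)) hx
  rw [← ContinuousLinearMap.adjoint_inner_left, ← ContinuousLinearMap.star_eq_adjoint, hs.star_eq]
    at h1
  exact inner_self_eq_zero.1 h1

variable (hR : IsSelfAdjoint R)
include hR

theorem apply_eq_cfc_apply (x : E) : R x = cfc (fun t : ℝ => t) R x := by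
  rw [cfc_id' ℝ R]

/-- On this subspace R ≥ c, so the inverse truncated at c is a true inverse. For R = (1 + A)⁻¹ it
exhibits x in the range of R, which is the domain of A. -/
theorem cfc_inv_max_apply {c : ℝ} (hc : 0 < c) {x : E} (hx : x ∈ upperSpace R c) :
    R (cfc (fun t : ℝ => (max t c)⁻¹) R x) = x := by
  have hpos : ∀ t, 0 < max t c := fun t => lt_max_of_lt_right hc
  have hg : Continuous fun t : ℝ => (max t c)⁻¹ :=
    Continuous.inv₀ (by fun_prop) fun t => (hpos t).ne'
  rw [apply_eq_cfc_apply hR, cfc_apply_cfc_apply (by fun_prop) hg]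
  have heq : (fun t : ℝ => t * (max t c)⁻¹) = fun t => 1 - c⁻¹ * max (c - t) 0 := by
    funext t
    rcases le_total c t with h | h
    · rw [max_eq_left h, max_eq_right (sub_nonpos.2 h), mul_inv_cancel₀ (by linarith)]; simp
    · rw [max_eq_right h, max_eq_left (sub_nonneg.2 h)]; field_simp; ring
  rw [heq, cfc_sub _ _ R (by fun_prop) (by fun_prop), cfc_const_mul _ _ R (by fun_prop),
    cfc_const_one ℝ R]
  simp [mem_upperSpace.1 hx]

/-- On the complement t may be capped at C, and the truncated inverse then takes values between C⁻¹
and c⁻¹. This is the source of the slice estimate for A. -/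
theorem norm_cfc_inv_max_sub_le {c C : ℝ} (hc : 0 < c) (hcC : c ≤ C) {x : E}
    (hx : x ∈ (upperSpace R C)ᗮ) :
    ‖cfc (fun t : ℝ => (max t c)⁻¹) R x - ((C⁻¹ : ℝ) : ℂ) • x‖ ≤ (c⁻¹ - C⁻¹) * ‖x‖ := by
  have hpos : ∀ t, 0 < max t c := fun t => lt_max_of_lt_right hc
  have hC : 0 < C := hc.trans_le hcC
  have hg : Continuous fun t : ℝ => (max t c)⁻¹ :=
    Continuous.inv₀ (by fun_prop) fun t => (hpos t).ne'
  have hg' : Continuous fun t : ℝ => (max (min t C) c)⁻¹ :=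
    Continuous.inv₀ (by fun_prop) fun t => (lt_max_of_lt_right hc).ne'
  have heq : (fun t : ℝ => (max t c)⁻¹)
      = fun t => (max (min t C) c)⁻¹ - (C⁻¹ * (max t c)⁻¹) * max (t - C) 0 := by
    funext t
    rcases le_total C t with h | h
    · rw [min_eq_right h, max_eq_left hcC, max_eq_left (sub_nonneg.2 h),
        max_eq_left (hcC.trans h)]
      have := hC.trans_le h
      field_simp; ring
    · rw [min_eq_left h, max_eq_right (sub_nonpos.2 h)]; simp
  have h1 : cfc (fun t : ℝ => (max t c)⁻¹) R x = cfc (fun t : ℝ => (max (min t C) c)⁻¹) R x := by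
    conv_lhs => rw [heq]
    rw [cfc_sub _ _ R hg'.continuousOn (by fun_prop), sub_apply,
      ← cfc_apply_cfc_apply (by fun_prop) (by fun_prop), cfc_posPart_eq_zero hx, map_zero, sub_zero]
  have h2 : cfc (fun t : ℝ => (max (min t C) c)⁻¹ - C⁻¹) R x
      = cfc (fun t : ℝ => (max (min t C) c)⁻¹) R x - ((C⁻¹ : ℝ) : ℂ) • x := by
    rw [cfc_sub _ _ R hg'.continuousOn (by fun_prop), cfc_const _ R, sub_apply,
      Algebra.algebraMap_eq_smul_one]
    congr 1
  rw [h1, ← h2]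
  refine (ContinuousLinearMap.le_opNorm _ _).trans ?_
  gcongr
  refine norm_cfc_le (sub_nonneg.2 (inv_anti₀ hc hcC)) fun t _ => ?_
  rw [Real.norm_eq_abs, abs_of_nonneg]
  · gcongr; exact le_max_right _ _
  · rw [sub_nonneg]
    exact inv_anti₀ (lt_max_of_lt_right hc) (max_le (min_le_right _ _) hcC)

-- (c - t)₊ is 1-Lipschitz in c uniformly in t. Since l ↦ (1 + l)⁻¹ reverses order, this left
-- continuity becomes right continuity of the spectral family.
omit hR in
theorem mem_upperSpace_of_forall_lt {c : ℝ} {x : E} (hx : ∀ c' < c, x ∈ upperSpace R c') :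
    x ∈ upperSpace R c := by
  rw [mem_upperSpace, ← norm_le_zero_iff]
  refine le_of_forall_pos_le_add fun ε hε => ?_
  have hd : 0 < ε / (‖x‖ + 1) := by positivity
  have h1 := mem_upperSpace.1 (hx (c - ε / (‖x‖ + 1)) (by linarith))
  have h2 : cfc (fun t : ℝ => max (c - t) 0 - max (c - ε / (‖x‖ + 1) - t) 0) R x
      = cfc (fun t : ℝ => max (c - t) 0) R x := by
    rw [cfc_sub _ _ R (by fun_prop) (by fun_prop), sub_apply, h1, sub_zero]
  rw [← h2, zero_add]
  calc _ ≤ ‖cfc (fun t : ℝ => max (c - t) 0 - max (c - ε / (‖x‖ + 1) - t) 0) R‖ * ‖x‖ :=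
        ContinuousLinearMap.le_opNorm _ _
    _ ≤ ε / (‖x‖ + 1) * ‖x‖ := by
        gcongr
        refine norm_cfc_le hd.le fun t _ => ?_
        rw [Real.norm_eq_abs]
        refine (abs_max_sub_max_le_abs _ _ _).trans ?_
        rw [show c - t - (c - ε / (‖x‖ + 1) - t) = ε / (‖x‖ + 1) by ring, abs_of_pos hd]
    _ ≤ ε := by
        rw [div_mul_eq_mul_div, div_le_iff₀ (by positivity)]
        nlinarith [norm_nonneg x]

-- (R - δ)₊ x lies in `upperSpace R δ` and is within δ‖x‖ of Rx.
omit hR in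
theorem apply_mem_closure_iSup_upperSpace (hR : 0 ≤ R) (x : E) :
    R x ∈ closure (⋃ c : Ioi (0 : ℝ), (upperSpace R c : Set E)) := by
  rw [Metric.mem_closure_iff]
  intro ε hε
  have hd : 0 < ε / (‖x‖ + 1) := by positivity
  refine ⟨_, mem_iUnion.2 ⟨⟨ε / (‖x‖ + 1), hd⟩, cfc_posPart_mem_upperSpace _ x⟩, ?_⟩
  have hs : IsSelfAdjoint R := .of_nonneg hR
  have h2 : cfc (fun t : ℝ => t - max (t - ε / (‖x‖ + 1)) 0) R x
      = R x - cfc (fun t : ℝ => max (t - ε / (‖x‖ + 1)) 0) R x := by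
    rw [cfc_sub _ _ R (by fun_prop) (by fun_prop), sub_apply, ← apply_eq_cfc_apply hs]
  rw [dist_eq_norm, ← h2]
  calc _ ≤ ‖cfc (fun t : ℝ => t - max (t - ε / (‖x‖ + 1)) 0) R‖ * ‖x‖ :=
        ContinuousLinearMap.le_opNorm _ _
    _ ≤ ε / (‖x‖ + 1) * ‖x‖ := by
        gcongr
        refine norm_cfc_le hd.le fun t ht => ?_
        have ht0 : 0 ≤ t := spectrum_nonneg_of_nonneg hR ht
        rw [Real.norm_eq_abs, abs_le]
        rcases le_total (t - ε / (‖x‖ + 1)) 0 with h | h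
        · rw [max_eq_right h]; constructor <;> linarith
        · rw [max_eq_left h]; constructor <;> linarith
    _ < ε := by
        rw [div_mul_eq_mul_div, div_lt_iff₀ (by positivity)]
        nlinarith [norm_nonneg x]

/-- Since R ≤ 1, (1 - R)₊ = 1 - R. For the resolvent, this eigenspace is the kernel of A. -/
theorem apply_eq_of_mem_upperSpace_one (hR1 : R ≤ 1) {x : E} (hx : x ∈ upperSpace R 1) :
    R x = x := by
  rw [mem_upperSpace] at hx
  have h : cfc (fun t : ℝ => max (1 - t) 0) R = cfc (fun t : ℝ => 1 - t) R := by
    refine cfc_congr fun t ht => max_eq_left ?_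
    have h1 : 0 ≤ cfc (fun t : ℝ => 1 - t) R := by
      rw [cfc_sub _ _ R (by fun_prop) (by fun_prop), cfc_const_one ℝ R, cfc_id' ℝ R]
      exact sub_nonneg.2 hR1
    exact (cfc_nonneg_iff (fun t : ℝ => 1 - t) R (by fun_prop)).1 h1 t ht
  rw [h, cfc_sub _ _ R (by fun_prop) (by fun_prop), cfc_const_one ℝ R, cfc_id' ℝ R] at hx
  exact (sub_eq_zero.1 hx).symm

end BoundedCalculus

/-! ### The spectral family built from the resolvent. -/

section Construction

variable {E : Type*} [NormedAddCommGroup E] [InnerProductSpace ℂ E] [CompleteSpace E]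

theorem norm_sub_apply_sq {p q : E →L[ℂ] E} (hp : IsStarProjection p) (hq : IsStarProjection q)
    (h : p ≤ q) (f : E) : ‖q f - p f‖ ^ 2 = ‖q f‖ ^ 2 - ‖p f‖ ^ 2 := by
  have hs : IsStarProjection (q - p) := (hp.le_iff_sub hq).1 h
  rw [← sub_apply, norm_sq_eq_reApplyInnerSelf hs, norm_sq_eq_reApplyInnerSelf hp,
    norm_sq_eq_reApplyInnerSelf hq]
  simp [ContinuousLinearMap.reApplyInnerSelf_apply, inner_sub_left]

theorem norm_apply_le_of_le {p q : E →L[ℂ] E} (hp : IsStarProjection p) (hq : IsStarProjection q)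
    (h : p ≤ q) (f : E) : ‖p f‖ ≤ ‖q f‖ := by
  have := norm_sub_apply_sq hp hq h f
  exact (sq_le_sq₀ (norm_nonneg _) (norm_nonneg _)).1 (by linarith [sq_nonneg ‖q f - p f‖])

/-- On orthogonal complements this is convergence of projections along an increasing sequence of
subspaces. -/
theorem tendsto_starProjection_iInf {U : ℕ → Submodule ℂ E} (V : Submodule ℂ E)
    [∀ n, (U n).HasOrthogonalProjection] [V.HasOrthogonalProjection] (hU : Antitone U)
    (hV : ⨅ n, U n = V) (f : E) :
    Tendsto (fun n => (U n).starProjection f) atTop (𝓝 (V.starProjection f)) := by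
  have h1 := Submodule.starProjection_tendsto_closure_iSup (fun n => (U n)ᗮ)
    (fun m n h => Submodule.orthogonal_le (hU h)) f
  have h2 : (⨆ n, (U n)ᗮ).topologicalClosure = Vᗮ := by
    rw [← Submodule.orthogonal_orthogonal_eq_closure, ← Submodule.iInf_orthogonal]
    simp only [Submodule.orthogonal_orthogonal, hV]
  simp only [h2] at h1
  have h3 := tendsto_const_nhds (x := f).sub h1
  simpa [Submodule.starProjection_orthogonal] using h3

/-- The spectral family of orthogonal projections onto an increasing right-continuous family of
closed subspaces. -/
noncomputable def SpectralFamily.ofSubspaces (U : ℝ → Submodule ℂ E)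
    (hcl : ∀ l, IsClosed (U l : Set E)) (hmono : Monotone U)
    (hright : ∀ l x, (∀ m > l, x ∈ U m) → x ∈ U l) (hbot : ∀ l < 0, U l = ⊥)
    (htop : ⊤ ≤ (⨆ l, U l).topologicalClosure) : SpectralFamily E :=
  have : ∀ l, CompleteSpace (U l) := fun l => (hcl l).completeSpace_coe
  { proj := fun l => (U l).starProjection
    isStarProjection := fun l => isStarProjection_starProjection
    mono := fun l m h => Submodule.starProjection_le_starProjection_iff.2 (hmono h)
    rightContinuous := by
      intro f l
      have hinf : ⨅ n : ℕ, U (l + 1 / ((n : ℝ) + 1)) = U l := by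
        refine le_antisymm (fun x hx => hright l x fun m hm => ?_)
          (le_iInf fun n => hmono (by simp; positivity))
        obtain ⟨n, hn⟩ := exists_nat_one_div_lt (sub_pos.2 hm)
        exact hmono (by linarith) ((Submodule.mem_iInf _).1 hx n)
      have hlim := tendsto_starProjection_iInf (U l)
        (U := fun n : ℕ => U (l + 1 / ((n : ℝ) + 1)))
        (fun m n h => hmono (by gcongr)) hinf f
      -- ‖P_m f - P_l f‖² = ‖P_m f‖² - ‖P_l f‖² increases with m, so a single point l + 1/(n+1)
      -- controls all m between.
      rw [Metric.continuousWithinAt_iff]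
      intro ε hε
      obtain ⟨n, hn⟩ := (Metric.tendsto_atTop.1 hlim ε hε)
      refine ⟨1 / ((n : ℝ) + 1), by positivity, fun {m} hm hm' => lt_of_le_of_lt ?_ (hn n le_rfl)⟩
      have hm : l ≤ m := hm
      rw [Real.dist_eq, abs_of_nonneg (by linarith)] at hm'
      rw [dist_eq_norm, dist_eq_norm, ← sq_le_sq₀ (norm_nonneg _) (norm_nonneg _),
        norm_sub_apply_sq, norm_sub_apply_sq]
      · have := norm_apply_le_of_le (p := (U m).starProjection)
          (q := (U (l + 1 / ((n : ℝ) + 1))).starProjection) isStarProjection_starProjection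
          isStarProjection_starProjection
          (Submodule.starProjection_le_starProjection_iff.2 (hmono (by linarith))) f
        gcongr
      all_goals first
        | exact isStarProjection_starProjection
        | exact Submodule.starProjection_le_starProjection_iff.2 (hmono (by linarith))
    tendsto_atBot := by
      intro f
      refine tendsto_const_nhds.congr' ?_
      filter_upwards [eventually_lt_atBot (0 : ℝ)] with l hl
      symm
      rw [Submodule.starProjection_apply_eq_zero_iff, hbot l hl]
      simp
    tendsto_atTop := fun f => Submodule.starProjection_tendsto_self U hmono f htop }

variable {R : E →L[ℂ] E}

/-- The range of `χ_A(]-∞, l])`, where `R = (1 + A)⁻¹`. -/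
noncomputable def lowerSpace (R : E →L[ℂ] E) (l : ℝ) : Submodule ℂ E :=
  if l < 0 then ⊥ else upperSpace R (1 + l)⁻¹

theorem lowerSpace_of_neg {l : ℝ} (hl : l < 0) : lowerSpace R l = ⊥ := if_pos hl

theorem lowerSpace_of_nonneg {l : ℝ} (hl : 0 ≤ l) : lowerSpace R l = upperSpace R (1 + l)⁻¹ :=
  if_neg (not_lt.2 hl)

theorem isClosed_lowerSpace (l : ℝ) : IsClosed (lowerSpace R l : Set E) := by
  rcases lt_or_ge l 0 with hl | hl
  · rw [lowerSpace_of_neg hl]; simp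
  · rw [lowerSpace_of_nonneg hl]; exact isClosed_upperSpace R _

theorem lowerSpace_mono : Monotone (lowerSpace R) := by
  intro l m h
  rcases lt_or_ge l 0 with hl | hl
  · rw [lowerSpace_of_neg hl]; exact bot_le
  · rw [lowerSpace_of_nonneg hl, lowerSpace_of_nonneg (hl.trans h)]
    exact upperSpace_anti R (by gcongr)

theorem mem_lowerSpace_of_forall_gt (l : ℝ) (x : E) (hx : ∀ m > l, x ∈ lowerSpace R m) :
    x ∈ lowerSpace R l := by
  rcases lt_or_ge l 0 with hl | hl
  · obtain ⟨m, hm, hm'⟩ := exists_between hl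
    have := hx m hm
    rwa [lowerSpace_of_neg hm', ← lowerSpace_of_neg (R := R) hl] at this
  · rw [lowerSpace_of_nonneg hl]
    refine mem_upperSpace_of_forall_lt fun c hc => ?_
    rcases le_or_gt c 0 with h0 | h0
    · have h1 := hx (l + 1) (by linarith)
      rw [lowerSpace_of_nonneg (by linarith)] at h1
      exact upperSpace_anti R (h0.trans (by positivity)) h1
    · have h2 : 1 + l < c⁻¹ := (lt_inv_comm₀ h0 (by positivity)).1 hc
      have h1 := hx (c⁻¹ - 1) (by linarith)
      rw [lowerSpace_of_nonneg (by linarith)] at h1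
      simpa using h1

theorem top_le_closure_iSup_lowerSpace (hR : 0 ≤ R) (hd : DenseRange R) :
    ⊤ ≤ (⨆ l, lowerSpace R l).topologicalClosure := by
  have h : (⋃ c : Ioi (0 : ℝ), (upperSpace R c : Set E)) ⊆ (⨆ l, lowerSpace R l : Submodule ℂ E) := by
    refine iUnion_subset fun c => ?_
    have hc : (0 : ℝ) < c := c.2
    refine fun x hx => Submodule.mem_iSup_of_mem (max 0 ((c : ℝ)⁻¹ - 1)) ?_
    rw [lowerSpace_of_nonneg (le_max_left _ _)]
    refine upperSpace_anti R (inv_le_of_inv_le₀ hc ?_) hx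
    linarith [le_max_right 0 ((c : ℝ)⁻¹ - 1)]
  intro x _
  rw [← SetLike.mem_coe, Submodule.topologicalClosure_coe]
  have h1 : closure (range R) ⊆ closure ((⨆ l, lowerSpace R l : Submodule ℂ E) : Set E) :=
    closure_minimal (range_subset_iff.2 fun y =>
      closure_mono h (apply_mem_closure_iSup_upperSpace hR y)) isClosed_closure
  exact h1 (hd x)

/-- The spectral family of `A`, where `R = (1 + A)⁻¹`. -/
noncomputable def resolventFamily (hR : 0 ≤ R) (hd : DenseRange R) : SpectralFamily E :=
  SpectralFamily.ofSubspaces (lowerSpace R) isClosed_lowerSpace lowerSpace_mono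
    mem_lowerSpace_of_forall_gt (fun _ => lowerSpace_of_neg)
    (top_le_closure_iSup_lowerSpace hR hd)

theorem resolventFamily_proj_mem (hR : 0 ≤ R) (hd : DenseRange R) (l : ℝ) (f : E) :
    (resolventFamily hR hd).proj l f ∈ lowerSpace R l :=
  have := (isClosed_lowerSpace (R := R) l).completeSpace_coe
  Submodule.starProjection_apply_mem _ f

theorem sub_resolventFamily_proj_mem (hR : 0 ≤ R) (hd : DenseRange R) (l : ℝ) (f : E) :
    f - (resolventFamily hR hd).proj l f ∈ (lowerSpace R l)ᗮ :=
  have := (isClosed_lowerSpace (R := R) l).completeSpace_coe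
  Submodule.sub_starProjection_mem_orthogonal f

theorem resolventFamily_proj_of_neg (hR : 0 ≤ R) (hd : DenseRange R) {l : ℝ} (hl : l < 0) (f : E) :
    (resolventFamily hR hd).proj l f = 0 := by
  have := resolventFamily_proj_mem hR hd l f
  rwa [lowerSpace_of_neg hl, Submodule.mem_bot] at this

/-- The projections commute with `R`. -/
theorem resolventFamily_proj_apply (hR : 0 ≤ R) (hd : DenseRange R) (l : ℝ) (f : E) :
    (resolventFamily hR hd).proj l (R f) = R ((resolventFamily hR hd).proj l f) := by
  have hs : IsSelfAdjoint R := .of_nonneg hR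
  have hinv : ∀ x ∈ lowerSpace R l, R x ∈ lowerSpace R l := by
    intro x hx
    rcases lt_or_ge l 0 with hl | hl
    · rw [lowerSpace_of_neg hl, Submodule.mem_bot] at hx ⊢
      rw [hx, map_zero]
    · rw [lowerSpace_of_nonneg hl] at hx ⊢
      rw [apply_eq_cfc_apply hs]
      exact cfc_apply_mem_upperSpace continuous_id hx
  have hort : ∀ x ∈ (lowerSpace R l)ᗮ, R x ∈ (lowerSpace R l)ᗮ := by
    intro x hx
    rw [Submodule.mem_orthogonal] at hx ⊢
    intro u hu
    rw [← ContinuousLinearMap.adjoint_inner_left, ← ContinuousLinearMap.star_eq_adjoint, hs.star_eq]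
    exact hx _ (hinv u hu)
  have := (isClosed_lowerSpace (R := R) l).completeSpace_coe
  refine Submodule.eq_starProjection_of_mem_orthogonal
    (hinv _ (resolventFamily_proj_mem hR hd l f)) ?_
  rw [← map_sub]
  exact hort _ (sub_resolventFamily_proj_mem hR hd l f)

end Construction

/-! ### Recognising Stieltjes integrals from their increments. -/

section StieltjesIntegral

/-- On n + 1 equal steps the errors telescope in F to a total of order 1/(n+1). -/
theorem eq_of_abs_sub_le_mul {F H : ℝ → ℝ} {C N : ℝ} (hN : 0 ≤ N)
    (h : ∀ x y, 0 ≤ x → x ≤ y → y ≤ N → |H y - H x| ≤ C * (y - x) * (F y - F x)) :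
    H N = H 0 := by
  have key : ∀ n : ℕ, |H N - H 0| ≤ C * N * (F N - F 0) * (1 / ((n : ℝ) + 1)) := by
    intro n
    have hn : (0 : ℝ) < (n : ℝ) + 1 := by positivity
    let p : ℕ → ℝ := fun k => N * (k / ((n : ℝ) + 1))
    have hp0 : p 0 = 0 := by simp [p]
    have hpn : p (n + 1) = N := by
      simp only [p]; push_cast; rw [div_self hn.ne', mul_one]
    have hstep : ∀ k, p (k + 1) - p k = N * (1 / ((n : ℝ) + 1)) := by
      intro k; simp only [p]; push_cast; ring
    have hmono : Monotone p := fun i j hij => by simp only [p]; gcongr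
    calc |H N - H 0| = |∑ k ∈ Finset.range (n + 1), (H (p (k + 1)) - H (p k))| := by
          rw [Finset.sum_range_sub (fun k => H (p k)), hp0, hpn]
      _ ≤ ∑ k ∈ Finset.range (n + 1), |H (p (k + 1)) - H (p k)| := Finset.abs_sum_le_sum_abs _ _
      _ ≤ ∑ k ∈ Finset.range (n + 1),
            C * (N * (1 / ((n : ℝ) + 1))) * (F (p (k + 1)) - F (p k)) := by
          refine Finset.sum_le_sum fun k hk => ?_
          rw [← hstep k]
          refine h _ _ (hp0 ▸ hmono (Nat.zero_le k)) (hmono k.le_succ) ?_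
          rw [← hpn]
          exact hmono (Finset.mem_range.1 hk)
      _ = C * N * (F N - F 0) * (1 / ((n : ℝ) + 1)) := by
          rw [← Finset.mul_sum, Finset.sum_range_sub (fun k => F (p k)), hp0, hpn]; ring
  have hlim : Tendsto (fun n : ℕ => C * N * (F N - F 0) * (1 / ((n : ℝ) + 1))) atTop (𝓝 0) := by
    simpa using tendsto_one_div_add_atTop_nhds_zero_nat.const_mul (C * N * (F N - F 0))
  have h0 := ge_of_tendsto' hlim key
  exact sub_eq_zero.1 (abs_eq_zero.1 (le_antisymm h0 (abs_nonneg _)))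

/-- G and the integral both have increment φ(x)(F y - F x) up to K(y - x)(F y - F x), so their
difference is constant. -/
theorem sub_eq_integral_stieltjes (F : StieltjesFunction ℝ) {G φ : ℝ → ℝ} (hφ : Continuous φ)
    {K N : ℝ} (hN : 0 ≤ N)
    (hG : ∀ x y, 0 ≤ x → x ≤ y → y ≤ N →
      |G y - G x - φ x * (F y - F x)| ≤ K * (y - x) * (F y - F x))
    (hφK : ∀ x y, 0 ≤ x → x ≤ y → y ≤ N → |φ y - φ x| ≤ K * (y - x)) :
    G N - G 0 = ∫ l in (0 : ℝ)..N, φ l ∂F.measure := by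
  have hint : ∀ x y, IntervalIntegrable φ F.measure x y := fun x y => hφ.intervalIntegrable x y
  have h := eq_of_abs_sub_le_mul (F := F) (H := fun x => G x - ∫ l in (0 : ℝ)..x, φ l ∂F.measure)
    (C := 2 * K) hN (by
    intro x y hx hxy hy
    have hF : 0 ≤ F y - F x := sub_nonneg.2 (F.mono hxy)
    have hm : F.measure.real (Ioc x y) = F y - F x := by
      rw [measureReal_def, F.measure_Ioc, ENNReal.toReal_ofReal hF]
    have h1 : (∫ l in (0 : ℝ)..y, φ l ∂F.measure) - ∫ l in (0 : ℝ)..x, φ l ∂F.measure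
        = ∫ l in x..y, φ l ∂F.measure :=
      intervalIntegral.integral_interval_sub_left (hint _ _) (hint _ _)
    have h2 : (∫ l in x..y, φ l ∂F.measure) - φ x * (F y - F x)
        = ∫ l in Ioc x y, (φ l - φ x) ∂F.measure := by
      rw [intervalIntegral.integral_of_le hxy, integral_sub, setIntegral_const, hm, smul_eq_mul,
        mul_comm]
      · exact (hint x y).1
      · exact (intervalIntegrable_const (μ := F.measure) (a := x) (b := y)).1
    have h3 : ‖∫ l in Ioc x y, (φ l - φ x) ∂F.measure‖ ≤ K * (y - x) * F.measure.real (Ioc x y) := by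
      refine norm_setIntegral_le_of_norm_le_const ?_ fun l hl => ?_
      · rw [F.measure_Ioc]; exact ENNReal.ofReal_lt_top
      · have hK : 0 ≤ K * (y - x) := (abs_nonneg _).trans (hφK x y hx hxy hy)
        have hxl : x < l := hl.1
        have hly : l ≤ y := hl.2
        have hK0 : 0 ≤ K := nonneg_of_mul_nonneg_left hK (by linarith)
        refine (hφK x l hx hxl.le (hly.trans hy)).trans ?_
        gcongr
    rw [← h2, hm, Real.norm_eq_abs] at h3
    have h4 := hG x y hx hxy hy
    rw [abs_le] at h3 h4 ⊢
    constructor <;> nlinarith)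
  simp only [intervalIntegral.integral_same, sub_zero] at h
  linarith

end StieltjesIntegral

/-! ### The spectral theorem for positive self-adjoint operators. -/

section SpectralTheorem

variable {E : Type*} [NormedAddCommGroup E] [InnerProductSpace ℂ E] [CompleteSpace E]

theorem SpectralFamily.distribution_apply (P : SpectralFamily E) (f : E) (l : ℝ) :
    P.distribution f l = ‖P.proj l f‖ ^ 2 := rfl

theorem SpectralFamily.tendsto_distribution_atBot (P : SpectralFamily E) (f : E) :
    Tendsto (P.distribution f) atBot (𝓝 0) := by
  have h := (P.tendsto_atBot f).norm.pow 2
  rw [norm_zero, zero_pow two_ne_zero] at h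
  exact h

theorem SpectralFamily.tendsto_distribution_atTop (P : SpectralFamily E) (f : E) :
    Tendsto (P.distribution f) atTop (𝓝 (‖f‖ ^ 2)) :=
  (P.tendsto_atTop f).norm.pow 2

instance (P : SpectralFamily E) (f : E) : IsFiniteMeasure (P.scalarMeasure f) :=
  StieltjesFunction.isFiniteMeasure _ (P.tendsto_distribution_atBot f)
    (P.tendsto_distribution_atTop f)

theorem SpectralFamily.proj_proj (P : SpectralFamily E) {l m : ℝ} (h : l ≤ m) (f : E) :
    P.proj l (P.proj m f) = P.proj l f :=
  congrArg (fun T : E →L[ℂ] E => T f)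
    (((P.isStarProjection l).le_iff_mul_eq_left (P.isStarProjection m)).1 (P.mono h))

theorem SpectralFamily.proj_proj' (P : SpectralFamily E) {l m : ℝ} (h : l ≤ m) (f : E) :
    P.proj m (P.proj l f) = P.proj l f :=
  congrArg (fun T : E →L[ℂ] E => T f)
    (((P.isStarProjection l).le_iff_mul_eq_right (P.isStarProjection m)).1 (P.mono h))

theorem SpectralFamily.norm_proj_sub_sq (P : SpectralFamily E) {l m : ℝ} (h : l ≤ m) (f : E) :
    ‖P.proj m f - P.proj l f‖ ^ 2 = P.distribution f m - P.distribution f l :=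
  norm_sub_apply_sq (P.isStarProjection l) (P.isStarProjection m) (P.mono h) f

theorem SpectralFamily.inner_proj_left (P : SpectralFamily E) (l : ℝ) (f g : E) :
    inner ℂ (P.proj l f) g = inner ℂ f (P.proj l g) := by
  have := ContinuousLinearMap.adjoint_inner_left (P.proj l) g f
  rwa [← ContinuousLinearMap.star_eq_adjoint, (P.isStarProjection l).isSelfAdjoint.star_eq] at this

theorem SpectralFamily.norm_proj_le (P : SpectralFamily E) (l : ℝ) (f : E) :
    ‖P.proj l f‖ ≤ ‖f‖ := by
  have := ContinuousLinearMap.le_of_opNorm_le _ (P.isStarProjection l).norm_le f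
  simpa using this

/-- A spectral family vanishing on the negative half-line which commutes with `A` and on whose
slices `A` is close to a scalar is the spectral family of `A`. -/
theorem isSpectralFamilyOf_of_slices {A : E →ₗ.[ℂ] E} (hA : IsPositiveSelfAdjoint A)
    (P : SpectralFamily E) (hneg : ∀ l < 0, ∀ f, P.proj l f = 0)
    (hdom : ∀ l f, P.proj l f ∈ A.domain)
    (hzero : ∀ f, A ⟨P.proj 0 f, hdom 0 f⟩ = 0)
    (hcomm : ∀ l (f : A.domain), A ⟨P.proj l f, hdom l f⟩ = P.proj l (A f))
    (hslice : ∀ x y f, 0 ≤ x → x ≤ y →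
      ‖A ⟨P.proj y f, hdom y f⟩ - A ⟨P.proj x f, hdom x f⟩ - (x : ℂ) • (P.proj y f - P.proj x f)‖
        ≤ (y - x) * ‖P.proj y f - P.proj x f‖) :
    IsSpectralFamilyOf P A := by
  set T : ℝ → E → E := fun l f => A ⟨P.proj l f, hdom l f⟩ with hT
  have hPT : ∀ {x y : ℝ}, x ≤ y → ∀ f, P.proj x (T y f) = T x f := by
    intro x y hxy f
    rw [hT]
    dsimp only
    rw [← hcomm x ⟨P.proj y f, hdom y f⟩]
    congr 1
    exact Subtype.ext (P.proj_proj hxy f)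
  have hPT' : ∀ {x y : ℝ}, x ≤ y → ∀ f, P.proj y (T x f) = T x f := by
    intro x y hxy f
    rw [← hPT le_rfl f, P.proj_proj' hxy]
  have hTsq : ∀ {x y : ℝ}, x ≤ y → ∀ f, ‖T y f - T x f‖ ^ 2 = ‖T y f‖ ^ 2 - ‖T x f‖ ^ 2 := by
    intro x y hxy f
    have := P.norm_proj_sub_sq hxy (T y f)
    rwa [P.distribution_apply, P.distribution_apply, hPT hxy, hPT le_rfl] at this
  have hT0 : ∀ f, T 0 f = 0 := hzero
  -- the first moment
  have hG1 : ∀ (f : E) (N : ℝ), 0 ≤ N →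
      (inner ℂ f (T N f)).re = ∫ l in (0 : ℝ)..N, l ∂(P.scalarMeasure f) := by
    intro f N hN
    have := sub_eq_integral_stieltjes (P.distribution f) (G := fun l => (inner ℂ f (T l f)).re)
      continuous_id (K := 1) hN (by
        intro x y hx hxy _
        set D := P.proj y f - P.proj x f
        -- P_y fixes T y f - T x f and P_x kills it, so f may be replaced by D.
        have e1 : (inner ℂ f (T y f)).re - (inner ℂ f (T x f)).re
            = (inner ℂ D (T y f - T x f)).re := by
          rw [inner_sub_left, P.inner_proj_left, P.inner_proj_left, map_sub, map_sub, hPT le_rfl,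
            hPT le_rfl, hPT hxy, hPT' hxy, sub_self, inner_zero_right, sub_zero, inner_sub_right,
            Complex.sub_re]
        have e2 : x * ‖D‖ ^ 2 = (inner ℂ D ((x : ℂ) • D)).re := by
          rw [inner_smul_right, Complex.re_ofReal_mul]
          congr 1
          exact (inner_self_eq_norm_sq (𝕜 := ℂ) D).symm
        have e3 := P.norm_proj_sub_sq hxy f
        simp only [id]
        rw [← e3, e1, e2, ← Complex.sub_re, ← inner_sub_right]
        refine (Complex.abs_re_le_norm _).trans ((norm_inner_le_norm _ _).trans ?_)
        have := mul_le_mul_of_nonneg_left (hslice x y f hx hxy) (norm_nonneg D)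
        refine this.trans (le_of_eq ?_)
        ring) (by
        intro x y _ hxy _
        rw [one_mul, id, id, abs_of_nonneg (sub_nonneg.2 hxy)])
    simpa [hT0, SpectralFamily.scalarMeasure] using this
  -- the second moment
  have hG2 : ∀ (f : E) (N : ℝ), 0 ≤ N →
      ‖T N f‖ ^ 2 = ∫ l in (0 : ℝ)..N, l ^ 2 ∂(P.scalarMeasure f) := by
    intro f N hN
    have := sub_eq_integral_stieltjes (P.distribution f) (G := fun l => ‖T l f‖ ^ 2)
      (φ := fun l => l ^ 2) (by fun_prop) (K := 2 * N) hN (by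
        intro x y hx hxy hy
        set D := P.proj y f - P.proj x f
        have e3 := P.norm_proj_sub_sq hxy f
        have h1 := hslice x y f hx hxy
        have h2 : ‖(x : ℂ) • D‖ = x * ‖D‖ := by
          rw [norm_smul, Complex.norm_real, Real.norm_of_nonneg hx]
        have h3 := (abs_norm_sub_norm_le (T y f - T x f) ((x : ℂ) • D)).trans h1
        rw [h2] at h3
        change |‖T y f‖ ^ 2 - ‖T x f‖ ^ 2 - x ^ 2 * _| ≤ _
        rw [← e3, ← hTsq hxy]
        have hD : 0 ≤ ‖D‖ := norm_nonneg D
        have hS : 0 ≤ ‖T y f - T x f‖ := norm_nonneg _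
        -- The slice bound gives ‖T y f - T x f‖ ≤ y‖D‖, and x, y ≤ N.
        have h4 : ‖T y f - T x f‖ + x * ‖D‖ ≤ 2 * N * ‖D‖ := by
          have := (abs_le.1 h3).2
          nlinarith
        rw [show ‖T y f - T x f‖ ^ 2 - x ^ 2 * ‖D‖ ^ 2
            = (‖T y f - T x f‖ - x * ‖D‖) * (‖T y f - T x f‖ + x * ‖D‖) by ring, abs_mul,
          abs_of_nonneg (a := ‖T y f - T x f‖ + x * ‖D‖) (by positivity)]
        calc _ ≤ ((y - x) * ‖D‖) * (2 * N * ‖D‖) :=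
              mul_le_mul h3 h4 (by positivity) (mul_nonneg (sub_nonneg.2 hxy) hD)
          _ = _ := by ring) (by
        intro x y hx hxy hy
        rw [abs_of_nonneg (by nlinarith)]
        nlinarith)
    simpa [hT0, SpectralFamily.scalarMeasure] using this
  -- the scalar measures live on the closed half-line
  have hIio : ∀ f, P.scalarMeasure f (Iio 0) = 0 := by
    intro f
    have h1 : ∀ n : ℕ, P.scalarMeasure f (Iic (-(1 / ((n : ℝ) + 1)))) = 0 := by
      intro n
      rw [SpectralFamily.scalarMeasure, StieltjesFunction.measure_Iic _
        (P.tendsto_distribution_atBot f), P.distribution_apply, hneg _ (by simp; positivity)]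
      simp
    refine measure_mono_null (fun x hx => ?_) (measure_iUnion_null h1)
    obtain ⟨n, hn⟩ := exists_nat_one_div_lt (neg_pos.2 (mem_Iio.1 hx))
    exact mem_iUnion.2 ⟨n, by rw [mem_Iic]; linarith⟩
  have hIic : ∀ f, ∀ᵐ l ∂((P.scalarMeasure f).restrict (Iic 0)), l = 0 := by
    intro f
    rw [ae_restrict_iff' measurableSet_Iic]
    have : ∀ᵐ l ∂(P.scalarMeasure f), l ∉ Iio (0 : ℝ) := measure_eq_zero_iff_ae_notMem.1 (hIio f)
    filter_upwards [this] with l h1 h2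
    exact le_antisymm h2 (not_lt.1 h1)
  have hsq : ∀ f, ∫⁻ l, ENNReal.ofReal (l ^ 2) ∂(P.scalarMeasure f)
      = ⨆ n : ℕ, ENNReal.ofReal (‖T n f‖ ^ 2) := by
    intro f
    rw [← lintegral_add_compl _ (measurableSet_Iic (a := (0 : ℝ))), compl_Iic]
    have h1 : ∫⁻ l in Iic (0 : ℝ), ENNReal.ofReal (l ^ 2) ∂(P.scalarMeasure f) = 0 := by
      rw [lintegral_eq_zero_iff (by fun_prop)]
      filter_upwards [hIic f] with l hl
      simp [hl]
    have h2 : (Ioi 0 : Set ℝ) = ⋃ n : ℕ, Ioc (0 : ℝ) n := by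
      ext x
      simp only [mem_Ioi, mem_iUnion, mem_Ioc, exists_and_left]
      exact ⟨fun h => ⟨h, exists_nat_ge x⟩, fun h => h.1⟩
    rw [h1, zero_add, h2, setLIntegral_iUnion_of_directed]
    · congr 1
      funext n
      rw [hG2 f n n.cast_nonneg, intervalIntegral.integral_of_le n.cast_nonneg,
        ofReal_integral_eq_lintegral_ofReal]
      · exact ((continuous_pow 2).intervalIntegrable 0 (n : ℝ)).1
      · exact Eventually.of_forall fun l => sq_nonneg l
    · exact (monotone_nat_of_le_succ fun n => Ioc_subset_Ioc_right (by simp)).directed_le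
  have hTdom : ∀ (f : A.domain), Tendsto (fun n : ℕ => T n f) atTop (𝓝 (A f)) := by
    intro f
    simp only [hT, hcomm]
    exact (P.tendsto_atTop (A f)).comp tendsto_natCast_atTop_atTop
  have hmem : ∀ f : E, f ∈ A.domain ↔
      ∫⁻ l, ENNReal.ofReal (l ^ 2) ∂(P.scalarMeasure f) < ∞ := by
    intro f
    rw [hsq]
    constructor
    · intro hf
      refine lt_of_le_of_lt (iSup_le fun n => ENNReal.ofReal_le_ofReal ?_)
        (ENNReal.ofReal_lt_top (r := ‖A ⟨f, hf⟩‖ ^ 2))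
      have := hcomm n ⟨f, hf⟩
      change T n f = _ at this
      rw [this]
      gcongr
      exact P.norm_proj_le _ _
    · intro hf
      -- A finite second moment bounds the increasing ‖T n f‖²; by orthogonality of slices T n f is
      -- Cauchy, and closedness of A puts f in the domain.
      have hmon : Monotone fun n : ℕ => ‖T n f‖ ^ 2 := by
        intro m n h
        have := hTsq (Nat.cast_le.2 h : (m : ℝ) ≤ n) f
        dsimp only
        linarith [sq_nonneg ‖T n f - T m f‖]
      have hbdd : BddAbove (range fun n : ℕ => ‖T n f‖ ^ 2) := by
        refine ⟨(⨆ n : ℕ, ENNReal.ofReal (‖T n f‖ ^ 2)).toReal, ?_⟩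
        rintro _ ⟨n, rfl⟩
        exact (ENNReal.ofReal_le_iff_le_toReal hf.ne).1
          (le_iSup (fun n : ℕ => ENNReal.ofReal (‖T n f‖ ^ 2)) n)
      have hcau := (tendsto_atTop_ciSup hmon hbdd).cauchySeq
      have hcau' : CauchySeq fun n : ℕ => T n f := by
        rw [Metric.cauchySeq_iff'] at hcau ⊢
        intro ε hε
        obtain ⟨N, hN⟩ := hcau (ε ^ 2) (by positivity)
        refine ⟨N, fun n hn => ?_⟩
        have h1 := hN n hn
        have h2 := hTsq (Nat.cast_le.2 hn : (N : ℝ) ≤ n) f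
        rw [Real.dist_eq, ← h2, abs_of_nonneg (sq_nonneg _)] at h1
        rw [dist_eq_norm]
        exact lt_of_pow_lt_pow_left₀ 2 hε.le h1
      obtain ⟨g, hg⟩ := cauchySeq_tendsto_of_complete hcau'
      obtain ⟨w, hw, -⟩ := hA.mem_domain_of_tendsto (z := fun n : ℕ => ⟨P.proj n f, hdom n f⟩)
        ((P.tendsto_atTop f).comp tendsto_natCast_atTop_atTop) hg
      exact hw ▸ w.2
  refine ⟨hmem, fun f => ?_⟩
  have hint2 : Integrable (fun l : ℝ => l ^ 2) (P.scalarMeasure f) := by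
    refine ⟨by fun_prop, ?_⟩
    rw [hasFiniteIntegral_iff_ofReal (Eventually.of_forall fun l => sq_nonneg l)]
    exact (hmem f).1 f.2
  have hint : Integrable (fun l : ℝ => l) (P.scalarMeasure f) := by
    refine Integrable.mono' (hint2.add (integrable_const (1 : ℝ))) (by fun_prop)
      (Eventually.of_forall fun l => ?_)
    simp only [Real.norm_eq_abs, Pi.add_apply]
    exact abs_le.2 ⟨by nlinarith [sq_nonneg (l + 1)], by nlinarith [sq_nonneg (l - 1)]⟩
  have hre : (inner ℂ (f : E) (A f)).re = ∫ l, l ∂(P.scalarMeasure f) := by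
    have h1 : ∫ l in Iic (0 : ℝ), l ∂(P.scalarMeasure f) = 0 :=
      integral_eq_zero_of_ae (hIic f)
    rw [← integral_add_compl (measurableSet_Iic (a := (0 : ℝ))) hint, compl_Iic, h1, zero_add]
    have h2 := intervalIntegral_tendsto_integral_Ioi (0 : ℝ) hint.integrableOn
      (tendsto_natCast_atTop_atTop (R := ℝ))
    refine tendsto_nhds_unique ?_ h2
    refine Tendsto.congr (fun n : ℕ => hG1 f n n.cast_nonneg) ?_
    exact (Complex.continuous_re.tendsto _).comp (tendsto_const_nhds.inner (hTdom f))
  have him : (inner ℂ (f : E) (A f)).im = 0 := by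
    have h1 := hA.inner_symm f f
    rw [← inner_conj_symm, Complex.conj_eq_iff_im] at h1
    exact h1
  exact Complex.ext (by rw [Complex.ofReal_re, hre]) (by rw [Complex.ofReal_im, him])

/-- The spectral theorem for positive self-adjoint operators. -/
theorem IsPositiveSelfAdjoint.exists_isSpectralFamilyOf {A : E →ₗ.[ℂ] E}
    (hA : IsPositiveSelfAdjoint A) : ∃ P, IsSpectralFamilyOf P A := by
  obtain ⟨R, hR, hR1, hRA, hAR⟩ := hA.exists_resolvent
  have hs : IsSelfAdjoint R := .of_nonneg hR
  have hd : DenseRange R := by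
    refine hA.isSelfAdjoint.dense_domain.mono fun z hz => ⟨z + A ⟨z, hz⟩, hAR ⟨z, hz⟩⟩
  set P := resolventFamily hR hd with hP
  have hmem : ∀ {l : ℝ}, 0 ≤ l → ∀ x ∈ lowerSpace R l, ∃ z : A.domain, (z : E) = x ∧
      A z = cfc (fun t : ℝ => (max t (1 + l)⁻¹)⁻¹) R x - x := by
    intro l hl x hx
    rw [lowerSpace_of_nonneg hl] at hx
    obtain ⟨z, hz, hz'⟩ := hRA (cfc (fun t : ℝ => (max t (1 + l)⁻¹)⁻¹) R x)
    rw [cfc_inv_max_apply hs (by positivity) hx] at hz hz'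
    exact ⟨z, hz, hz'⟩
  have hdom : ∀ l f, P.proj l f ∈ A.domain := by
    intro l f
    rcases lt_or_ge l 0 with hl | hl
    · rw [hP, resolventFamily_proj_of_neg hR hd hl]; exact A.domain.zero_mem
    · obtain ⟨z, hz, -⟩ := hmem hl _ (resolventFamily_proj_mem hR hd l f)
      rw [hP, ← hz]; exact z.2
  refine ⟨P, isSpectralFamilyOf_of_slices hA P
    (fun l hl f => resolventFamily_proj_of_neg hR hd hl f) hdom ?_ ?_ ?_⟩
  · intro f
    have h1 := resolventFamily_proj_mem hR hd 0 f
    rw [lowerSpace_of_nonneg le_rfl, add_zero, inv_one] at h1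
    have h2 := apply_eq_of_mem_upperSpace_one hs hR1 h1
    obtain ⟨z, hz, hz'⟩ := hRA (P.proj 0 f)
    rw [h2] at hz hz'
    rw [← sub_self (P.proj 0 f)]
    refine Eq.trans ?_ hz'
    congr 1
    exact Subtype.ext hz.symm
  · intro l f
    -- R sends f + Af to f, so P_l f = R(P_l(f + Af)), where A acts through AR = 1 - R.
    have h1 := resolventFamily_proj_apply hR hd l (f + A f)
    rw [hAR] at h1
    obtain ⟨z, hz, hz'⟩ := hRA (P.proj l (f + A f))
    rw [← h1] at hz hz'
    have h2 : P.proj l (A f) = P.proj l (f + A f) - P.proj l f := by rw [map_add]; abel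
    rw [h2]
    refine Eq.trans ?_ hz'
    congr 1
    exact Subtype.ext hz.symm
  · intro x y f hx hxy
    have h1 : P.proj y f - P.proj x f ∈ lowerSpace R y :=
      Submodule.sub_mem _ (resolventFamily_proj_mem hR hd y f)
        (lowerSpace_mono hxy (resolventFamily_proj_mem hR hd x f))
    have h2 : P.proj y f - P.proj x f ∈ (lowerSpace R x)ᗮ := by
      have := sub_resolventFamily_proj_mem hR hd x (P.proj y f)
      rwa [P.proj_proj hxy] at this
    rw [lowerSpace_of_nonneg hx] at h2
    obtain ⟨z, hz, hz'⟩ := hmem (hx.trans hxy) _ h1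
    have h3 : z = ⟨P.proj y f, hdom y f⟩ - ⟨P.proj x f, hdom x f⟩ := Subtype.ext hz
    -- Since A = R⁻¹ - 1, energies x ≤ y correspond to the values (1+x)⁻¹ ≥ (1+y)⁻¹ of R, and the
    -- width c⁻¹ - C⁻¹ is y - x.
    have h4 := norm_cfc_inv_max_sub_le hs (c := (1 + y)⁻¹) (C := (1 + x)⁻¹)
      (inv_pos.2 (by linarith)) (by gcongr) h2
    rw [← LinearPMap.map_sub, ← h3, hz']
    rw [inv_inv, inv_inv] at h4
    refine le_trans (le_of_eq ?_) (h4.trans (le_of_eq ?_))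
    · congr 1
      push_cast
      rw [add_smul, one_smul]
      abel
    · ring

theorem IsPositiveSelfAdjoint.isSpectralFamilyOf {A : E →ₗ.[ℂ] E}
    (hA : IsPositiveSelfAdjoint A) : IsSpectralFamilyOf (spectralFamily A) A :=
  Classical.epsilon_spec hA.exists_isSpectralFamilyOf

end SpectralTheorem

/-! ### The kernel of A and the layer-cake formula for the form. -/

section Kernel

variable {E : Type*} [NormedAddCommGroup E] [InnerProductSpace ℂ E] [CompleteSpace E]
  {A : E →ₗ.[ℂ] E}

/-- The quadratic t ↦ ⟨g + th, A(g + th)⟩ is non-negative without constant term, so its linear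
coefficient 2Re⟨h, Ag⟩ vanishes; density of the domain then allows h = Ag. -/
theorem IsPositiveSelfAdjoint.apply_eq_zero (hA : IsPositiveSelfAdjoint A) {g : A.domain}
    (hg : (inner ℂ (g : E) (A g)).re ≤ 0) : A g = 0 := by
  have h0 : (inner ℂ (g : E) (A g)).re = 0 := le_antisymm hg (hA.nonneg g)
  have h1 : ∀ h : A.domain, (inner ℂ (h : E) (A g)).re = 0 := by
    intro h
    have h2 : ∀ t : ℝ, 0 ≤ (inner ℂ (h : E) (A h)).re * (t * t)
        + (2 * (inner ℂ (h : E) (A g)).re) * t + 0 := by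
      intro t
      have h3 := hA.nonneg (g + (t : ℂ) • h)
      have h4 : (inner ℂ (g : E) (A h)).re = (inner ℂ (h : E) (A g)).re := by
        rw [← hA.inner_symm, ← inner_conj_symm, Complex.conj_re]
      rw [LinearPMap.map_add, LinearPMap.map_smul, Submodule.coe_add, Submodule.coe_smul,
        inner_add_left, inner_add_right, inner_add_right, inner_smul_left, inner_smul_left,
        inner_smul_right, inner_smul_right] at h3
      simp only [Complex.add_re, Complex.conj_ofReal, Complex.re_ofReal_mul, h0, h4] at h3
      linarith
    have h5 := discrim_le_zero h2
    rw [discrim] at h5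
    nlinarith [sq_nonneg (inner ℂ (h : E) (A g)).re]
  have h2 : ∀ x : E, (inner ℂ x (A g)).re = 0 := by
    intro x
    have hcl : IsClosed {x : E | (inner ℂ x (A g)).re = 0} :=
      isClosed_eq (by fun_prop) continuous_const
    exact hcl.closure_subset_iff.2 (fun y hy => h1 ⟨y, hy⟩)
      (hA.isSelfAdjoint.dense_domain x)
  have h3 : ‖A g‖ ^ 2 = 0 := by
    rw [← h2 (A g)]; exact (inner_self_eq_norm_sq (𝕜 := ℂ) _).symm
  simpa using h3

theorem SpectralFamily.measure_Ioi (P : SpectralFamily E) (f : E) (l : ℝ) :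
    P.scalarMeasure f (Ioi l) = ENNReal.ofReal (‖f - P.proj l f‖ ^ 2) := by
  have h := norm_sub_apply_sq (P.isStarProjection l) (IsStarProjection.one (E →L[ℂ] E))
    (P.isStarProjection l).le_one f
  rw [one_apply_eq_self] at h
  rw [h, SpectralFamily.scalarMeasure,
    StieltjesFunction.measure_Ioi _ (P.tendsto_distribution_atTop f), P.distribution_apply]

/-- The slices of the spectral family on bounded intervals below `0` lie in the kernel. -/
theorem IsSpectralFamilyOf.slice_mem_ker {P : SpectralFamily E} (hA : IsPositiveSelfAdjoint A)
    (hP : IsSpectralFamilyOf P A) (f : E) {a : ℝ} (ha : a ≤ 0) :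
    ∃ g : A.domain, (g : E) = P.proj 0 f - P.proj a f ∧ A g = 0 := by
  set g := P.proj 0 f - P.proj a f with hg
  have h1 : P.scalarMeasure g (Ioi 0) = 0 := by
    rw [P.measure_Ioi, hg, map_sub, P.proj_proj le_rfl, P.proj_proj' ha, sub_self]
    simp
  have h2 : P.scalarMeasure g (Iic a) = 0 := by
    rw [SpectralFamily.scalarMeasure, StieltjesFunction.measure_Iic _
      (P.tendsto_distribution_atBot g), P.distribution_apply, hg, map_sub, P.proj_proj ha,
      P.proj_proj le_rfl, sub_self]
    simp
  -- The spectral measure of g lives on ]a, 0]: hence g is in the domain and ⟨g, Ag⟩ ≤ 0.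
  have h3 : ∀ᵐ l ∂(P.scalarMeasure g), a < l ∧ l ≤ 0 := by
    filter_upwards [measure_eq_zero_iff_ae_notMem.1 h1, measure_eq_zero_iff_ae_notMem.1 h2]
      with l hl hl'
    exact ⟨not_le.1 hl', not_lt.1 hl⟩
  have hdom : g ∈ A.domain := by
    rw [hP.1]
    calc ∫⁻ l, ENNReal.ofReal (l ^ 2) ∂(P.scalarMeasure g)
        ≤ ∫⁻ _, ENNReal.ofReal (a ^ 2) ∂(P.scalarMeasure g) := by
          refine lintegral_mono_ae ?_
          filter_upwards [h3] with l hl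
          exact ENNReal.ofReal_le_ofReal (by nlinarith [hl.1, hl.2])
      _ < ∞ := by
          rw [lintegral_const]
          exact ENNReal.mul_lt_top ENNReal.ofReal_lt_top (measure_lt_top _ _)
  refine ⟨⟨g, hdom⟩, rfl, hA.apply_eq_zero ?_⟩
  rw [hP.2 ⟨g, hdom⟩, Complex.ofReal_re]
  exact integral_nonpos_of_ae (h3.mono fun l hl => hl.2)

theorem IsSpectralFamilyOf.apply_proj_zero {P : SpectralFamily E} (hA : IsPositiveSelfAdjoint A)
    (hP : IsSpectralFamilyOf P A) {ρ : E →L[ℂ] E} (hρ : ∀ f : A.domain, A f = 0 → ρ f = 0) (f : E) :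
    ρ (P.proj 0 f) = 0 := by
  have h1 : ∀ᶠ a : ℝ in atBot, ρ (P.proj 0 f - P.proj a f) = 0 := by
    filter_upwards [eventually_le_atBot (0 : ℝ)] with a ha
    obtain ⟨g, hg, hg'⟩ := hP.slice_mem_ker hA f ha
    rw [← hg]
    exact hρ g hg'
  have h2 : Tendsto (fun a => ρ (P.proj 0 f - P.proj a f)) atBot (𝓝 (ρ (P.proj 0 f - 0))) :=
    (ρ.continuous.tendsto _).comp (tendsto_const_nhds.sub (P.tendsto_atBot f))
  rw [sub_zero] at h2
  exact tendsto_nhds_unique h2 (tendsto_const_nhds.congr' (h1.mono fun a h => h.symm))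

theorem quadForm_eq_lintegral (A : E →ₗ.[ℂ] E) (f : E) :
    quadForm A f
      = ∫⁻ l in Ioi (0 : ℝ), ENNReal.ofReal (‖f - (spectralFamily A).proj l f‖ ^ 2) := by
  -- The layer-cake formula needs a non-negative function; `ENNReal.ofReal` discards negative l
  -- anyway.
  have h := lintegral_eq_lintegral_meas_lt ((spectralFamily A).scalarMeasure f)
    (f := fun l : ℝ => max l 0) (Eventually.of_forall fun l => le_max_right l 0) (by fun_prop)
  have h1 : ∀ l : ℝ, ENNReal.ofReal (max l 0) = ENNReal.ofReal l := fun l => by simp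
  simp only [h1] at h
  rw [quadForm, h]
  refine setLIntegral_congr_fun measurableSet_Ioi fun t ht => ?_
  have h2 : {a : ℝ | t < max a 0} = Ioi t := by
    ext a
    have ht : 0 < t := ht
    simp [ht.not_gt]
  rw [h2, SpectralFamily.measure_Ioi]

theorem proj_eq_self_of_quadForm_eq_zero {f : E} (hf : quadForm A f = 0) {l : ℝ} (hl : 0 < l) :
    (spectralFamily A).proj l f = f := by
  have h1 : ∀ᵐ t ∂((spectralFamily A).scalarMeasure f), t ∉ Ioi l := by
    have := (lintegral_eq_zero_iff (by fun_prop)).1 hf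
    filter_upwards [this] with t ht
    have : t ≤ 0 := by simpa using ht
    exact not_lt.2 (this.trans hl.le)
  have h2 := measure_eq_zero_iff_ae_notMem.2 h1
  rw [SpectralFamily.measure_Ioi, ENNReal.ofReal_eq_zero] at h2
  have h3 : ‖f - (spectralFamily A).proj l f‖ ^ 2 = 0 := le_antisymm h2 (sq_nonneg _)
  rw [sq_eq_zero_iff, norm_eq_zero, sub_eq_zero] at h3
  exact h3.symm

end Kernel

/-! ### Hilbert–Schmidt norms and square roots. -/

section HilbertSchmidt

variable {E : Type*} [NormedAddCommGroup E] [InnerProductSpace ℂ E] [CompleteSpace E]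

/-- The squared Hilbert–Schmidt norm. -/
noncomputable def hsSq (T : E →L[ℂ] E) : ℝ≥0∞ := formTrace fun f => ENNReal.ofReal (‖T f‖ ^ 2)

omit [CompleteSpace E] in
theorem ofReal_norm_sq_eq_tsum {ι : Type*} (b : HilbertBasis ι ℂ E) (x : E) :
    ENNReal.ofReal (‖x‖ ^ 2) = ∑' j, ENNReal.ofReal (‖inner ℂ (b j) x‖ ^ 2) := by
  have h := b.hasSum_inner_mul_inner x x
  have h1 : ∀ j, inner ℂ x (b j) * inner ℂ (b j) x = ((‖inner ℂ (b j) x‖ ^ 2 : ℝ) : ℂ) := by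
    intro j
    rw [← inner_conj_symm, Complex.conj_mul']
    push_cast; rfl
  simp only [h1] at h
  rw [inner_self_eq_norm_sq_to_K] at h
  have h2 : HasSum (fun j => ‖inner ℂ (b j) x‖ ^ 2) (‖x‖ ^ 2) := by
    rw [← Complex.hasSum_ofReal]
    simpa using h
  rw [← h2.tsum_eq, ENNReal.ofReal_tsum_of_nonneg (fun j => sq_nonneg _) h2.summable]

/-- By Parseval both sides are the double sum of squared matrix entries, in opposite orders. -/
theorem hsSq_eq_of_adjoint {S T : E →L[ℂ] E} (h : ∀ x y, inner ℂ (S x) y = inner ℂ x (T y)) :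
    hsSq S = hsSq T := by
  unfold hsSq formTrace
  simp only [ofReal_norm_sq_eq_tsum (basis E)]
  rw [ENNReal.tsum_comm]
  refine tsum_congr fun j => tsum_congr fun i => ?_
  rw [← h, ← inner_conj_symm, RCLike.norm_conj]

theorem hsSq_le_two_mul {S T U : E →L[ℂ] E} (h : ∀ x, S x = T x + U x) :
    hsSq S ≤ 2 * hsSq T + 2 * hsSq U := by
  unfold hsSq formTrace
  rw [← ENNReal.tsum_mul_left, ← ENNReal.tsum_mul_left, ← ENNReal.tsum_add]
  refine ENNReal.tsum_le_tsum fun i => ?_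
  beta_reduce
  rw [h, ← ENNReal.ofReal_ofNat 2, ← ENNReal.ofReal_mul zero_le_two,
    ← ENNReal.ofReal_mul zero_le_two, ← ENNReal.ofReal_add (by positivity) (by positivity)]
  refine ENNReal.ofReal_le_ofReal ?_
  have := norm_add_le (T (basis E i)) (U (basis E i))
  nlinarith [sq_nonneg (‖T (basis E i)‖ - ‖U (basis E i)‖), norm_nonneg (T (basis E i)),
    norm_nonneg (U (basis E i)), norm_nonneg (T (basis E i) + U (basis E i))]

/-- The positive square root of a bounded positive operator. -/
noncomputable def opSqrt (ρ : E →L[ℂ] E) : E →L[ℂ] E := CFC.sqrt ρ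

theorem energy_eq (A : E →ₗ.[ℂ] E) (ρ : E →L[ℂ] E) :
    energy A ρ = formTrace fun f => quadForm A (opSqrt ρ f) := rfl

theorem inner_sqrt_left {ρ : E →L[ℂ] E} (x y : E) :
    inner ℂ (opSqrt ρ x) y = inner ℂ x (opSqrt ρ y) := by
  have hs : IsSelfAdjoint (opSqrt ρ) := .of_nonneg (CFC.sqrt_nonneg ρ)
  have := ContinuousLinearMap.adjoint_inner_left (opSqrt ρ) y x
  rwa [← ContinuousLinearMap.star_eq_adjoint, hs.star_eq] at this

theorem re_inner_eq_norm_sqrt_sq {ρ : E →L[ℂ] E} (hρ : 0 ≤ ρ) (x : E) :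
    (inner ℂ x (ρ x)).re = ‖opSqrt ρ x‖ ^ 2 := by
  have h : opSqrt ρ (opSqrt ρ x) = ρ x :=
    congrArg (fun T : E →L[ℂ] E => T x) (CFC.sqrt_mul_sqrt_self ρ hρ)
  rw [← h, ← inner_sqrt_left]
  exact inner_self_eq_norm_sq (𝕜 := ℂ) _

theorem norm_sqrt_sq_le {ρ : E →L[ℂ] E} (hρ : 0 ≤ ρ) (x : E) :
    ‖opSqrt ρ x‖ ^ 2 ≤ ‖ρ‖ * ‖x‖ ^ 2 := by
  rw [← re_inner_eq_norm_sqrt_sq hρ]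
  calc (inner ℂ x (ρ x)).re ≤ ‖x‖ * ‖ρ x‖ := re_inner_le_norm (𝕜 := ℂ) _ _
    _ ≤ ‖x‖ * (‖ρ‖ * ‖x‖) := by gcongr; exact ρ.le_opNorm x
    _ = _ := by ring

theorem hsSq_sqrt_comp_le {ρ : E →L[ℂ] E} (hρ : 0 ≤ ρ) (T : E →L[ℂ] E) :
    hsSq (opSqrt ρ ∘L T) ≤ ‖ρ‖ₑ * hsSq T := by
  unfold hsSq formTrace
  rw [← ENNReal.tsum_mul_left]
  refine ENNReal.tsum_le_tsum fun i => ?_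
  rw [← ofReal_norm, ← ENNReal.ofReal_mul (norm_nonneg _)]
  exact ENNReal.ofReal_le_ofReal (norm_sqrt_sq_le hρ _)

theorem sqrt_apply_eq_zero {ρ : E →L[ℂ] E} (hρ : 0 ≤ ρ) {x : E} (hx : ρ x = 0) :
    opSqrt ρ x = 0 := by
  have := re_inner_eq_norm_sqrt_sq hρ x
  rw [hx, inner_zero_right, Complex.zero_re] at this
  simpa using this.symm

end HilbertSchmidt

/-! ### Cutoffs χ_Ω and the measures ν. -/

section Indicator

variable {X : Type*} [MeasurableSpace X] {μ : Measure X}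
  {H : Type*} [NormedAddCommGroup H] [InnerProductSpace ℂ H]

theorem coeFn_chi {Ω : Set X} (hΩ : MeasurableSet Ω) (f : Lp H 2 μ) :
    chi hΩ f =ᵐ[μ] Ω.indicator f :=
  ((Lp.memLp f).indicator hΩ).coeFn_toLp

omit [InnerProductSpace ℂ H] in
theorem ofReal_norm_sq_eq_lintegral (f : Lp H 2 μ) :
    ENNReal.ofReal (‖f‖ ^ 2) = ∫⁻ x, ‖f x‖ₑ ^ 2 ∂μ := by
  rw [ENNReal.ofReal_pow (norm_nonneg _), ofReal_norm, Lp.enorm_def,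
    eLpNorm_eq_lintegral_rpow_enorm_toReal two_ne_zero ENNReal.ofNat_ne_top, ← ENNReal.rpow_natCast,
    ← ENNReal.rpow_mul]
  simp

theorem tsum_ofReal_norm_chi_sq {ι : Type*} [Countable ι] {Ω : ι → Set X}
    (hΩ : ∀ i, MeasurableSet (Ω i)) (hdisj : Pairwise (Function.onFun Disjoint Ω))
    (hcover : ⋃ i, Ω i = univ) (f : Lp H 2 μ) :
    ∑' i, ENNReal.ofReal (‖chi (hΩ i) f‖ ^ 2) = ENNReal.ofReal (‖f‖ ^ 2) := by
  rw [ofReal_norm_sq_eq_lintegral f, ← setLIntegral_univ, ← hcover, lintegral_iUnion hΩ hdisj]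
  refine tsum_congr fun i => ?_
  rw [ofReal_norm_sq_eq_lintegral, ← lintegral_indicator (hΩ i)]
  refine lintegral_congr_ae ?_
  filter_upwards [coeFn_chi (hΩ i) f] with x hx
  rw [hx]
  by_cases h : x ∈ Ω i <;> simp [h]

variable [CompleteSpace H]

omit [CompleteSpace H] in
theorem inner_chi_left {Ω : Set X} (hΩ : MeasurableSet Ω) (f g : Lp H 2 μ) :
    inner ℂ (chi hΩ f) g = inner ℂ f (chi hΩ g) := by
  rw [L2.inner_def, L2.inner_def]
  refine integral_congr_ae ?_
  filter_upwards [coeFn_chi hΩ f, coeFn_chi hΩ g] with x h1 h2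
  rw [h1, h2]
  by_cases h : x ∈ Ω <;> simp [h]

theorem nu_eq_hsSq_sqrt {ρ : Lp H 2 μ →L[ℂ] Lp H 2 μ} (hρ : 0 ≤ ρ) {Ω : Set X}
    (hΩ : MeasurableSet Ω) : nu ρ hΩ = hsSq (opSqrt ρ ∘L chi hΩ) := by
  refine tsum_congr fun i => ?_
  simp only [ContinuousLinearMap.comp_apply]
  rw [← inner_chi_left, re_inner_eq_norm_sqrt_sq hρ]

theorem nu_eq_hsSq {Q : Lp H 2 μ →L[ℂ] Lp H 2 μ} (hQ : IsStarProjection Q) {Ω : Set X}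
    (hΩ : MeasurableSet Ω) : nu Q hΩ = hsSq (Q ∘L chi hΩ) := by
  refine tsum_congr fun i => ?_
  simp only [ContinuousLinearMap.comp_apply]
  rw [← inner_chi_left, norm_sq_eq_reApplyInnerSelf hQ,
    ContinuousLinearMap.reApplyInnerSelf_apply, inner_re_symm]
  rfl

theorem nu_mono {P Q : Lp H 2 μ →L[ℂ] Lp H 2 μ} (h : P ≤ Q) {Ω : Set X}
    (hΩ : MeasurableSet Ω) : nu P hΩ ≤ nu Q hΩ := by
  refine ENNReal.tsum_le_tsum fun i => ENNReal.ofReal_le_ofReal ?_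
  simp only [ContinuousLinearMap.comp_apply]
  rw [← inner_chi_left, ← inner_chi_left, ← sub_nonneg, ← Complex.sub_re, ← inner_sub_right,
    ← sub_apply]
  exact ((ContinuousLinearMap.le_def _ _).1 h).re_inner_nonneg_right _

end Indicator

/-! ### Measurability in the energy variable. -/

section Measurability

/-- `p n x` is the first multiple of 1/(n+1) strictly above x; h ∘ p n factors through ℤ, and p n x
tends to x from the right. -/
theorem measurable_of_rightContinuous {h : ℝ → ℝ} (hh : ∀ l, ContinuousWithinAt h (Ici l) l) :
    Measurable h := by
  let p : ℕ → ℝ → ℝ := fun n x => ((⌊((n : ℝ) + 1) * x⌋ : ℝ) + 1) / ((n : ℝ) + 1)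
  have hm : ∀ n, Measurable fun x => h (p n x) := by
    intro n
    have h1 : Measurable fun k : ℤ => h (((k : ℝ) + 1) / ((n : ℝ) + 1)) := measurable_from_top
    exact h1.comp (Int.measurable_floor.comp (measurable_const_mul _))
  refine measurable_of_tendsto_metrizable hm (tendsto_pi_nhds.2 fun x => ?_)
  have hlow : ∀ n, x ≤ p n x := by
    intro n
    rw [le_div_iff₀ (by positivity), mul_comm]
    exact (Int.lt_floor_add_one _).le
  have hup : ∀ n : ℕ, p n x ≤ x + 1 / ((n : ℝ) + 1) := by
    intro n
    have hn : (0 : ℝ) < (n : ℝ) + 1 := by positivity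
    rw [div_le_iff₀ hn, add_mul x, one_div_mul_cancel hn.ne', mul_comm x]
    gcongr
    exact Int.floor_le _
  have hlim : Tendsto (fun n => p n x) atTop (𝓝 x) := by
    refine tendsto_of_tendsto_of_tendsto_of_le_of_le tendsto_const_nhds ?_ hlow hup
    simpa using tendsto_one_div_add_atTop_nhds_zero_nat.const_add x
  exact (hh x).tendsto.comp
    (tendsto_nhdsWithin_iff.2 ⟨hlim, Eventually.of_forall fun n => hlow n⟩)

end Measurability

/-! ### The local inequality, its integration and summation. -/

section MainInequality

variable {X : Type*} [MeasurableSpace X] {μ : Measure X}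
  {H : Type*} [NormedAddCommGroup H] [InnerProductSpace ℂ H] [CompleteSpace H]
  {A : Lp H 2 μ →ₗ.[ℂ] Lp H 2 μ} {ρ : Lp H 2 μ →L[ℂ] Lp H 2 μ}

/-- The trace of `χ_Ω (1 - P_l) ρ (1 - P_l) χ_Ω`, computed as a squared Hilbert–Schmidt norm. -/
noncomputable def tailNu (A : Lp H 2 μ →ₗ.[ℂ] Lp H 2 μ) (ρ : Lp H 2 μ →L[ℂ] Lp H 2 μ) {Ω : Set X}
    (hΩ : MeasurableSet Ω) (l : ℝ) : ℝ≥0∞ :=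
  hsSq (chi hΩ ∘L (1 - (spectralFamily A).proj l) ∘L opSqrt ρ)

/-- `hQP` lets Q stand for either kind of projection: S only has to see Q as P_l. -/
theorem nu_le_four_mul_tailNu (hρ : 0 ≤ ρ) (hρ0 : ρ ≠ 0) {Ω : Set X} (hΩ : MeasurableSet Ω)
    {Q : Lp H 2 μ →L[ℂ] Lp H 2 μ} (hQ : IsStarProjection Q) {l : ℝ}
    (hQP : ∀ f, opSqrt ρ (Q f) = opSqrt ρ ((spectralFamily A).proj l f))
    (h : nu Q hΩ ≤ nu ρ hΩ / (4 * ‖ρ‖ₑ)) (hfin : nu Q hΩ < ∞) :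
    nu ρ hΩ ≤ 4 * tailNu A ρ hΩ l := by
  have hr : ‖ρ‖ₑ ≠ 0 := by simpa using hρ0
  have hr' : ‖ρ‖ₑ ≠ ∞ := enorm_ne_top
  have h1 : hsSq (opSqrt ρ ∘L (1 - (spectralFamily A).proj l) ∘L chi hΩ) = tailNu A ρ hΩ l := by
    refine hsSq_eq_of_adjoint fun x y => ?_
    simp only [ContinuousLinearMap.comp_apply]
    rw [inner_sqrt_left, ← inner_chi_left, sub_apply, sub_apply, one_apply_eq_self,
      one_apply_eq_self, inner_sub_left, inner_sub_right, SpectralFamily.inner_proj_left]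
  have h2 : nu ρ hΩ ≤ 2 * (‖ρ‖ₑ * nu Q hΩ) + 2 * tailNu A ρ hΩ l := by
    rw [nu_eq_hsSq_sqrt hρ, nu_eq_hsSq hQ, ← h1]
    refine (hsSq_le_two_mul (T := opSqrt ρ ∘L Q ∘L chi hΩ)
      (U := opSqrt ρ ∘L (1 - (spectralFamily A).proj l) ∘L chi hΩ) fun x => ?_).trans ?_
    · simp only [ContinuousLinearMap.comp_apply]
      rw [hQP, ← map_add, sub_apply, one_apply_eq_self, add_sub_cancel]
    · gcongr
      exact hsSq_sqrt_comp_le hρ _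
  have h3 : 4 * (‖ρ‖ₑ * nu Q hΩ) ≤ nu ρ hΩ := by
    rw [ENNReal.le_div_iff_mul_le (Or.inl (by simp [hr])) (Or.inl (ENNReal.mul_ne_top (by simp) hr'))]
      at h
    calc 4 * (‖ρ‖ₑ * nu Q hΩ) = nu Q hΩ * (4 * ‖ρ‖ₑ) := by ring
      _ ≤ _ := h
  -- Absorbing half of ν_ρ(Ω) requires it to be finite; otherwise finiteness of ν_Q(Ω) forces the
  -- tail to be infinite.
  by_cases htop : nu ρ hΩ = ∞
  · rw [htop, top_le_iff, ENNReal.add_eq_top] at h2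
    rcases h2 with h2 | h2
    · exact absurd h2 (ENNReal.mul_ne_top (by simp) (ENNReal.mul_ne_top hr' hfin.ne))
    · have : tailNu A ρ hΩ l = ∞ := by
        by_contra hne
        exact ENNReal.mul_ne_top (by simp) hne h2
      rw [this, ENNReal.mul_top (by simp)]
      exact le_top
  · refine (ENNReal.add_le_add_iff_left htop).1 ?_
    calc nu ρ hΩ + nu ρ hΩ = 2 * nu ρ hΩ := by ring
      _ ≤ 2 * (2 * (‖ρ‖ₑ * nu Q hΩ) + 2 * tailNu A ρ hΩ l) := by gcongr
      _ = 4 * (‖ρ‖ₑ * nu Q hΩ) + 4 * tailNu A ρ hΩ l := by ring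
      _ ≤ _ := by gcongr

theorem rightInv_mul_nu_le (hρ : 0 ≤ ρ) (hρ0 : ρ ≠ 0) {Ω : Set X} (hΩ : MeasurableSet Ω)
    {Q : ℝ≥0 → Lp H 2 μ →L[ℂ] Lp H 2 μ} (hQ : ∀ l, IsStarProjection (Q l)) (hmono : Monotone Q)
    (hQP : ∀ l f, opSqrt ρ (Q l f) = opSqrt ρ ((spectralFamily A).proj l f)) :
    rightInv (fun l => nu (Q l) hΩ) (nu ρ hΩ / (4 * ‖ρ‖ₑ)) * nu ρ hΩ
      ≤ 4 * ∫⁻ l in Ioi (0 : ℝ), tailNu A ρ hΩ l := by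
  unfold rightInv
  split_ifs with h0
  · simp
  simp only [ENNReal.iSup_mul]
  refine iSup₂_le fun l hl => ?_
  rw [← lintegral_const_mul' _ _ (by simp)]
  calc (l : ℝ≥0∞) * nu ρ hΩ = ∫⁻ _ in Ioc (0 : ℝ) l, nu ρ hΩ := by
        rw [setLIntegral_const, Real.volume_Ioc, sub_zero, ENNReal.ofReal_coe_nnreal, mul_comm]
    _ ≤ ∫⁻ t in Ioc (0 : ℝ) l, 4 * tailNu A ρ hΩ t := by
        refine setLIntegral_mono' measurableSet_Ioc fun t ht => ?_
        lift t to ℝ≥0 using ht.1.le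
        -- Every t ≤ l inherits the condition at l, so the local bound holds on all of ]0, l].
        have hle : nu (Q t) hΩ ≤ nu (Q l) hΩ := nu_mono (hmono (by exact_mod_cast ht.2)) hΩ
        exact nu_le_four_mul_tailNu hρ hρ0 hΩ (hQ t) (hQP t) (hle.trans hl.1) (hle.trans_lt hl.2)
    _ ≤ _ := lintegral_mono_set Ioc_subset_Ioi_self

theorem measurable_chi_tail (A : Lp H 2 μ →ₗ.[ℂ] Lp H 2 μ) {Ω : Set X} (hΩ : MeasurableSet Ω)
    (f : Lp H 2 μ) :
    Measurable fun l : ℝ => ENNReal.ofReal (‖chi hΩ (f - (spectralFamily A).proj l f)‖ ^ 2) := by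
  refine (measurable_of_rightContinuous fun l => ?_).ennreal_ofReal
  have h := (spectralFamily A).rightContinuous f l
  exact (((chi hΩ).continuous.continuousAt.comp_continuousWithinAt
    (continuousWithinAt_const.sub h)).norm.pow 2)

theorem tsum_lintegral_tailNu_le {ι : Type*} [Countable ι] {Ω : ι → Set X}
    (hΩ : ∀ i, MeasurableSet (Ω i)) (hdisj : Pairwise (Function.onFun Disjoint Ω))
    (hcover : ⋃ i, Ω i = univ) :
    ∑' i, ∫⁻ l in Ioi (0 : ℝ), tailNu A ρ (hΩ i) l ≤ energy A ρ := by
  rw [energy_eq]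
  unfold formTrace
  set g := fun k => opSqrt ρ (basis (Lp H 2 μ) k) with hg
  by_cases htop : ∑' k, quadForm A (g k) = ∞
  · rw [htop]; exact le_top
  -- The Hilbert basis may be uncountable, while exchanging sum and integral needs countability;
  -- finite energy leaves only countably many relevant basis vectors.
  have hC : (Function.support fun k => quadForm A (g k)).Countable :=
    Summable.countable_support_ennreal htop
  set C := Function.support fun k => quadForm A (g k) with hCdef
  have := hC.to_subtype
  have h1 : ∀ i, ∀ l ∈ Ioi (0 : ℝ), tailNu A ρ (hΩ i) l
      = ∑' k : C, ENNReal.ofReal (‖chi (hΩ i) (g k - (spectralFamily A).proj l (g k))‖ ^ 2) := by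
    intro i l hl
    have h2 : (Function.support fun k =>
        ENNReal.ofReal (‖chi (hΩ i) (g k - (spectralFamily A).proj l (g k))‖ ^ 2)) ⊆ C := by
      intro k hk hk0
      apply hk
      simp only
      rw [proj_eq_self_of_quadForm_eq_zero hk0 hl, sub_self, map_zero]
      simp
    rw [tsum_subtype_eq_of_support_subset h2]
    rfl
  calc ∑' i, ∫⁻ l in Ioi (0 : ℝ), tailNu A ρ (hΩ i) l
      = ∑' i, ∑' k : C, ∫⁻ l in Ioi (0 : ℝ),
          ENNReal.ofReal (‖chi (hΩ i) (g k - (spectralFamily A).proj l (g k))‖ ^ 2) := by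
        refine tsum_congr fun i => ?_
        rw [setLIntegral_congr_fun measurableSet_Ioi (h1 i),
          lintegral_tsum fun k : C => (measurable_chi_tail A (hΩ i) (g k)).aemeasurable]
    _ = ∑' k : C, quadForm A (g k) := by
        rw [ENNReal.tsum_comm]
        refine tsum_congr fun k => ?_
        rw [← lintegral_tsum fun i => (measurable_chi_tail A (hΩ i) (g k)).aemeasurable,
          quadForm_eq_lintegral]
        simp only [tsum_ofReal_norm_chi_sq hΩ hdisj hcover]
    _ ≤ ∑' k, quadForm A (g k) := ENNReal.tsum_comp_le_tsum_of_injective Subtype.val_injective _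

theorem tsum_rightInv_mul_nu_le (hρ : 0 ≤ ρ) (hρ0 : ρ ≠ 0) {ι : Type*} [Countable ι]
    {Ω : ι → Set X} (hΩ : ∀ i, MeasurableSet (Ω i)) (hdisj : Pairwise (Function.onFun Disjoint Ω))
    (hcover : ⋃ i, Ω i = univ) {Q : ℝ≥0 → Lp H 2 μ →L[ℂ] Lp H 2 μ}
    (hQ : ∀ l, IsStarProjection (Q l)) (hmono : Monotone Q)
    (hQP : ∀ l f, opSqrt ρ (Q l f) = opSqrt ρ ((spectralFamily A).proj l f)) :
    ∑' i, rightInv (fun l => nu (Q l) (hΩ i)) (nu ρ (hΩ i) / (4 * ‖ρ‖ₑ)) * nu ρ (hΩ i)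
      ≤ 4 * energy A ρ :=
  calc _ ≤ ∑' i, 4 * ∫⁻ l in Ioi (0 : ℝ), tailNu A ρ (hΩ i) l :=
        ENNReal.tsum_le_tsum fun i => rightInv_mul_nu_le hρ hρ0 (hΩ i) hQ hmono hQP
    _ ≤ 4 * energy A ρ := by
        rw [ENNReal.tsum_mul_left]
        gcongr
        exact tsum_lintegral_tailNu_le hΩ hdisj hcover

end MainInequality

end MixedState

theorem mainTheorem5
    {X : Type*} [MeasurableSpace X] (μ : MeasureTheory.Measure X)
    {H : Type*} [NormedAddCommGroup H] [InnerProductSpace ℂ H] [CompleteSpace H]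
    (A : MeasureTheory.Lp H 2 μ →ₗ.[ℂ] MeasureTheory.Lp H 2 μ)
    (hA : MixedState.IsPositiveSelfAdjoint A)
    (ρ : MeasureTheory.Lp H 2 μ →L[ℂ] MeasureTheory.Lp H 2 μ)
    (hρ : ρ.IsPositive) (hρ0 : ρ ≠ 0)
    {ι : Type*} [Countable ι] (Ω : ι → Set X) (hΩ : ∀ i, MeasurableSet (Ω i))
    (hdisj : Pairwise (Function.onFun Disjoint Ω)) (hcover : ⋃ i, Ω i = Set.univ) :
    -- the projections `χ_A([0, l])`, with `ρ` arbitrary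
    (∑' i, MixedState.rightInv
          (fun l : ℝ≥0 => MixedState.nu (MixedState.specProjIcc A l) (hΩ i))
          (MixedState.nu ρ (hΩ i) / (4 * ‖ρ‖ₑ)) * MixedState.nu ρ (hΩ i)
        ≤ 4 * MixedState.energy A ρ) ∧
    -- the projections `χ_A(]0, l])`, with `ρ = 0` on `ker A`
    ((∀ f : A.domain, A f = 0 → ρ f = 0) →
      ∑' i, MixedState.rightInv
          (fun l : ℝ≥0 => MixedState.nu (MixedState.specProjIoc A l) (hΩ i))
          (MixedState.nu ρ (hΩ i) / (4 * ‖ρ‖ₑ)) * MixedState.nu ρ (hΩ i)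
        ≤ 4 * MixedState.energy A ρ) := by
  have hρ' : 0 ≤ ρ := (ContinuousLinearMap.nonneg_iff_isPositive ρ).2 hρ
  set P := MixedState.spectralFamily A with hP
  refine ⟨MixedState.tsum_rightInv_mul_nu_le hρ' hρ0 hΩ hdisj hcover
    (Q := fun l => MixedState.specProjIcc A l) (fun l => P.isStarProjection l)
    (fun l m h => P.mono (by exact_mod_cast h)) fun l f => rfl, fun hker => ?_⟩
  refine MixedState.tsum_rightInv_mul_nu_le hρ' hρ0 hΩ hdisj hcover
    (Q := fun l => MixedState.specProjIoc A l) (fun l => ?_) (fun l m h => ?_) fun l f => ?_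
  · exact ((P.isStarProjection 0).le_iff_sub (P.isStarProjection l)).1 (P.mono l.2)
  · exact sub_le_sub_right (P.mono (by exact_mod_cast h)) _
  -- ρ vanishes on ker A, hence on the range of P_0, and so does ρ^{1/2}; subtracting P_0 is
  -- therefore invisible to ρ^{1/2}.
  · have h0 := MixedState.sqrt_apply_eq_zero hρ' (hA.isSpectralFamilyOf.apply_proj_zero hA hker f)
    rw [MixedState.specProjIoc, sub_apply, map_sub, h0, sub_zero]
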